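/- Let $n\ge 1$, $\alpha=\pi/(2n+1)$, and let $\Delta_0\subset\mathbb{E}^2$ be an isosceles triangle with angles $\alpha,n\alpha,n\alpha$. *Setting.* Represent an oriented line by an affine function $f(p)=\langle a,p\rangle+c$ on $\mathbb{E}^2$ with $\langle a,a\rangle=2$, put $(f,g)=\langle a_f,a_g\rangle$ and $\Pi_f=\{f<0\}$. A seed $(\mathbf v,B)$, up to simultaneous permutation of indices, consists of three such functions $v_1,v_2,v_3$ and a skew-symmetric real $3\times3$ matrix $B$ with $|b_{ij}|=|(v_i,v_j)|$, regarded as a quiver ($i\to j$ iff $b_{ij}>0$) on the sides of the triangle (or infinite region bounded by a segment and two parallel half-lines) $\Delta=\bigcap_i\Pi_{v_i}$. The initial seed is $\Delta_0$ with the acyclic quiver base $\to$ first leg $\to$ second leg, base $\to$ second leg. The belt line $b$ is the line through the feet of the altitudes of $\Delta_0$ on the source and on the sink. A function $f$ is positive if all sufficiently far points of $b$, in the direction from the source to the sink, lie in $\Pi_f$. The mutation $\mu_k$ mutates $B$ as usual, replaces $v_k$ by $-v_k$, and replaces $v_i$ ($i\ne k$) by $v_i-(v_i,v_k)v_k$ if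 $v_k$ is positive and $b_{ik}<0$, or if $v_k$ is not positive and $b_{ik}>0$; the other $v_i$ are kept. The exchange graph $\Gamma$ has as vertices all seeds obtained from the initial seed by sequences of mutations, and as edges single mutations. A seed is translated or reflected by moving its triangle and keeping its quiver. An acyclic belt is a maximal connected full subgraph of $\Gamma$ containing only seeds with acyclic quiver. The initial acyclic belt is $I=(I_m)_{m\in\mathbb Z}$, where $I_0$ is the initial seed and $I_{m+1}$ is obtained from $I_m$ by mutation at a source. Let $L$ be the $\mathbb Z$-module spanned by the lengths of all vectors $w$ such that $\Gamma$ contains two seeds that differ by translation by $w$; identify $l\in L$ with the vector $l\,e$, where $e$ is the unit vector along $b$ from the source to the sink. **Theorem.** 1. The belt $I$ exists, and for every $w\in L$ the translated path $I+w$, with vertices $(I_m+w)_{m\in\mathbb Z}$ and edges between consecutive vertices, is a full subgraph of $\Gamma$; it is an acyclic belt. 2. There is a vector $h$ with $2h\in L$ such that the following holds. Let $n_1,n_2,n_3\ge0$ be integers with $n_1+n_2+n_3=2n+1$ and $\gcd(n_1,n_2,n_3)=1$. There is a triangle (an infinite region, if some $n_i=0$) $\Delta$ with angles $n_1\alpha,n_2\alpha,n_3\alpha$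 ($n_i\alpha$ opposite to the side $i$) to which every triangle or region with these angles that occurs in $\Gamma$ is congruent. Let $Q$ be a quiver on the sides of $\Delta$ whose arrow between two sides that enclose the angle $\theta$ has weight $2|\cos\theta|$, and which is acyclic if $\Delta$ is acute-angled and cyclic if $\Delta$ has an obtuse angle; if $\Delta$ is an infinite region, let moreover the arrow between the two sides of the obtuse angle start at the finite side. Then, up to translation by vectors in $L$, there are exactly two seeds in $\Gamma$ whose triangle is congruent to $\Delta$ and whose quiver is $Q$ (under the congruence). Any two such seeds are related by a translation by a vector in $L$, or by the glide reflection that consists of the reflection across $b$ and the translation by $h$, followed by a translation by a vector in $L$. -/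

import Mathlib

open scoped EuclideanGeometry

noncomputable section

namespace AffineSeed

/-- The Euclidean plane. -/
abbrev Plane : Type := EuclideanSpace ℝ (Fin 2)

/-- The three-dimensional space of affine linear functions on the plane: the pair `(a, c)` stands
for the function `p ↦ ⟪a, p⟫ + c`. -/
abbrev AffFun : Type := Plane × ℝ

/-- The value of an affine linear function at a point. -/
def AffFun.eval (f : AffFun) (p : Plane) : ℝ := inner ℝ f.1 p + f.2

/-- The (degenerate) symmetric bilinear form on affine linear functions: the scalar product of the
linear parts. -/
def AffFun.form (f g : AffFun) : ℝ := inner ℝ f.1 g.1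

/-- The open half-plane where an affine linear function is negative. Thus the linear part of `f` is
an outward normal vector of this half-plane. -/
def AffFun.halfPlane (f : AffFun) : Set Plane := {p | f.eval p < 0}

/-- The image of an affine linear function under an isometry `φ` of the plane, that is,
`f ∘ φ⁻¹`; see `AffFun.eval_move`. -/
def AffFun.move (φ : Plane ≃ᵃⁱ[ℝ] Plane) (f : AffFun) : AffFun :=
  (φ.linearIsometryEquiv f.1, f.eval (φ.symm 0))

theorem AffFun.eval_move (φ : Plane ≃ᵃⁱ[ℝ] Plane) (f : AffFun) (p : Plane) :
    (f.move φ).eval p = f.eval (φ.symm p) := by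
  have h : φ.symm p = φ.linearIsometryEquiv.symm p + φ.symm 0 := by
    have := φ.symm.map_vadd (0 : Plane) p
    rw [vadd_eq_add, vadd_eq_add, add_zero] at this
    exact this
  simp only [AffFun.move, AffFun.eval, h, inner_add_right]
  rw [← φ.linearIsometryEquiv.inner_map_map f.1 (φ.linearIsometryEquiv.symm p)]
  simp [add_assoc]

/-- The domain of a triple of affine linear functions: the intersection of the three half-planes.
For a seed this is an open triangle, or an infinite region bounded by two parallel half-lines and
a segment. -/
def domain (v : Fin 3 → AffFun) : Set Plane := ⋂ i, (v i).halfPlane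

/-- The domain of `v` is a triangle or an infinite region with interior angles `θ`. The angle `θ i`
is opposite to the side `i`, so it is the interior angle between the sides `i + 1` and `i + 2`,
hence the supplement of the angle between their outward normal vectors (it is `0` if these sides are
parallel with opposite outward normal vectors). -/
def HasAngles (v : Fin 3 → AffFun) (θ : Fin 3 → ℝ) : Prop :=
  (domain v).Nonempty ∧
    ∀ i, Real.pi - InnerProductGeometry.angle (v (i + 1)).1 (v (i + 2)).1 = θ i

/-- Congruence of domains with labelled sides. -/
def AreCongruent (v v' : Fin 3 → AffFun) : Prop :=
  ∃ φ : Plane ≃ᵃⁱ[ℝ] Plane, ∀ i, v i = (v' i).move φ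

/-! ### Exchange matrices -/

/-- Matrix mutation. -/
def mutateMatrix (B : Matrix (Fin 3) (Fin 3) ℝ) (k : Fin 3) : Matrix (Fin 3) (Fin 3) ℝ :=
  fun i j => if k = i ∨ k = j then -B i j
    else B i j + (B i k * |B k j| + |B i k| * B k j) / 2

/-- The quiver of `B` (with an arrow `i → j` whenever `B i j > 0`) has no oriented cycle. -/
def IsAcyclic (B : Matrix (Fin 3) (Fin 3) ℝ) : Prop :=
  ∀ i, ¬ Relation.TransGen (fun a b => 0 < B a b) i i

/-- The vertex `k` of the quiver of `B` is a source. -/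
def IsSource (B : Matrix (Fin 3) (Fin 3) ℝ) (k : Fin 3) : Prop := ∀ i, 0 ≤ B k i

/-! ### Seeds and their mutations -/

/-- A triple of vectors together with an exchange matrix, with labelled entries. The initial seed
below is a geometric realisation of its matrix, that is, the vectors `v i` form a basis of squared
lengths `2`, the absolute values of their products are those of the entries of `B`, and the signs of
these products are compatible with `B`; mutation preserves this. -/
@[ext]
structure LabelledSeed where
  /-- the vectors of the geometric realisation -/
  v : Fin 3 → AffFun
  /-- the exchange matrix -/
  B : Matrix (Fin 3) (Fin 3) ℝ

/-- Simultaneous permutation of vectors and of rows and columns. -/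
def LabelledSeed.perm (x : LabelledSeed) (σ : Equiv.Perm (Fin 3)) : LabelledSeed :=
  ⟨x.v ∘ σ, x.B.submatrix σ σ⟩

/-- Two labelled seeds are identified if they differ by a permutation of the labels. -/
instance seedSetoid : Setoid LabelledSeed where
  r x y := ∃ σ : Equiv.Perm (Fin 3), y = x.perm σ
  iseqv :=
    { refl := fun x => ⟨1, by ext <;> simp [LabelledSeed.perm]⟩
      symm := by
        rintro x _ ⟨σ, rfl⟩
        exact ⟨σ⁻¹, by ext <;> simp [LabelledSeed.perm]⟩
      trans := by
        rintro x _ _ ⟨σ, rfl⟩ ⟨τ, rfl⟩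
        exact ⟨σ * τ, by ext <;> simp [LabelledSeed.perm]⟩ }

/-- Seeds, up to permutation of the labels. -/
abbrev Seed : Type := Quotient seedSetoid

/-- The image of a labelled seed under an isometry of the plane, with the same quiver. -/
def LabelledSeed.move (φ : Plane ≃ᵃⁱ[ℝ] Plane) (x : LabelledSeed) : LabelledSeed :=
  ⟨fun i => (x.v i).move φ, x.B⟩

/-- The image of a seed under an isometry of the plane, with the same quiver. -/
def Seed.move (φ : Plane ≃ᵃⁱ[ℝ] Plane) : Seed → Seed :=
  Quotient.map (LabelledSeed.move φ) (by
    rintro x _ ⟨σ, rfl⟩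
    exact ⟨σ, rfl⟩)

/-- The translated seed `w + s`. -/
def Seed.translate (w : Plane) (s : Seed) : Seed :=
  s.move (AffineIsometryEquiv.constVAdd ℝ Plane w)

/-- The exchange matrix of a seed is acyclic. -/
def Seed.IsAcyclic (s : Seed) : Prop :=
  ∃ x : LabelledSeed, (⟦x⟧ : Seed) = s ∧ AffineSeed.IsAcyclic x.B

open Classical in
/-- Seed mutation in direction `k` by partial reflections, with respect to a set `pos` of positive
vectors. -/
def LabelledSeed.mutate (pos : Set AffFun) (x : LabelledSeed) (k : Fin 3) : LabelledSeed where
  v := fun i =>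
    if i = k then -x.v k
    else if (x.v k ∈ pos ∧ x.B i k < 0) ∨ (x.v k ∉ pos ∧ 0 < x.B i k) then
      x.v i - (x.v i).form (x.v k) • x.v k
    else x.v i
  B := mutateMatrix x.B k

/-! ### The initial seed, the belt line and the exchange graph -/

/-- The affine linear function, with linear part of squared length `2`, that vanishes on the side of
`Δ` opposite to the vertex `i` and that is negative at the vertex `i`. -/
def sideFun (Δ : Affine.Triangle ℝ Plane) (i : Fin 3) : AffFun :=
  let a : Plane := (√2 / ‖Δ.altitudeFoot i - Δ.points i‖) • (Δ.altitudeFoot i - Δ.points i)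
  (a, -inner ℝ a (Δ.altitudeFoot i))

/-- The fundamental angle. -/
def fundAngle (n : ℕ) : ℝ := Real.pi / (2 * n + 1)

/-- `Δ` is an isosceles triangle with angle `α` at the vertex `0` and angles `n α` at the vertices
`1` and `2`. -/
def IsInitialTriangle (n : ℕ) (Δ : Affine.Triangle ℝ Plane) : Prop :=
  ∠ (Δ.points 1) (Δ.points 0) (Δ.points 2) = fundAngle n ∧
  ∠ (Δ.points 0) (Δ.points 1) (Δ.points 2) = n * fundAngle n ∧
  ∠ (Δ.points 0) (Δ.points 2) (Δ.points 1) = n * fundAngle n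

/-- The initial labelled seed. The side `i` is opposite to the vertex `i`; the arrows of the quiver
are `0 → 1`, `0 → 2` and `1 → 2`, so the base `0` is the source and the leg `2` is the sink. -/
def initialLabelledSeed (n : ℕ) (Δ : Affine.Triangle ℝ Plane) : LabelledSeed where
  v := sideFun Δ
  B := !![0, 2 * Real.cos (n * fundAngle n), 2 * Real.cos (n * fundAngle n);
          -(2 * Real.cos (n * fundAngle n)), 0, 2 * Real.cos (fundAngle n);
          -(2 * Real.cos (n * fundAngle n)), -(2 * Real.cos (fundAngle n)), 0]

/-- The initial seed. -/
def initialSeed (n : ℕ) (Δ : Affine.Triangle ℝ Plane) : Seed := ⟦initialLabelledSeed n Δ⟧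

/-- The belt line: the line through the feet of the altitudes of the initial triangle on the source
and on the sink. -/
def beltLine (Δ : Affine.Triangle ℝ Plane) : AffineSubspace ℝ Plane :=
  line[ℝ, Δ.altitudeFoot 0, Δ.altitudeFoot 2]

instance (Δ : Affine.Triangle ℝ Plane) : Nonempty (beltLine Δ) :=
  ⟨⟨Δ.altitudeFoot 0, left_mem_affineSpan_pair ℝ _ _⟩⟩

/-- The reflection across the belt line. -/
def beltReflection (Δ : Affine.Triangle ℝ Plane) : Plane ≃ᵃⁱ[ℝ] Plane :=
  EuclideanGeometry.reflection (beltLine Δ)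

/-- The vector along the belt line from the source to the sink. -/
def beltVector (Δ : Affine.Triangle ℝ Plane) : Plane := Δ.altitudeFoot 2 - Δ.altitudeFoot 0

/-- The positive vectors. The reference point lies infinitely far away on the belt line in the
direction from the source to the sink: it belongs to a half-plane if all points of the belt line
that are far enough in this direction do. -/
def positive (Δ : Affine.Triangle ℝ Plane) : Set AffFun :=
  {f | ∀ᶠ t : ℝ in Filter.atTop, Δ.altitudeFoot 0 + t • beltVector Δ ∈ f.halfPlane}

/-- The vertices of the exchange graph: the seeds obtained from the initial seed by sequences of
mutations. -/
def mutationClass (n : ℕ) (Δ : Affine.Triangle ℝ Plane) : Set Seed :=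
  {s | ∃ x : LabelledSeed, (⟦x⟧ : Seed) = s ∧
    Relation.ReflTransGen (fun y z => ∃ k, z = y.mutate (positive Δ) k)
      (initialLabelledSeed n Δ) x}

/-- The exchange graph of the initial seed. -/
def exchangeGraph (n : ℕ) (Δ : Affine.Triangle ℝ Plane) : SimpleGraph (mutationClass n Δ) :=
  SimpleGraph.fromRel fun s t => ∃ (x : LabelledSeed) (k : Fin 3),
    (⟦x⟧ : Seed) = s ∧ (⟦x.mutate (positive Δ) k⟧ : Seed) = t

/-- An acyclic belt: (the vertex set of) a maximal connected full subgraph of the exchange graph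
that contains only acyclic seeds. -/
def IsAcyclicBelt (n : ℕ) (Δ : Affine.Triangle ℝ Plane) (J : Set (mutationClass n Δ)) : Prop :=
  Maximal (fun K : Set (mutationClass n Δ) =>
    (∀ s ∈ K, (s : Seed).IsAcyclic) ∧ ((exchangeGraph n Δ).induce K).Connected) J

/-- The labelling of the initial acyclic belt: `I 0` is the initial seed and `I (m + 1)` is obtained
from `I m` by a mutation at a source. -/
def IsInitialBelt (n : ℕ) (Δ : Affine.Triangle ℝ Plane) (I : ℤ → mutationClass n Δ) : Prop :=
  (I 0 : Seed) = initialSeed n Δ ∧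
  ∀ m, ∃ (x : LabelledSeed) (k : Fin 3), (⟦x⟧ : Seed) = I m ∧ IsSource x.B k ∧
    (⟦x.mutate (positive Δ) k⟧ : Seed) = I (m + 1)

/-- The group of real numbers spanned by the lengths of all translation vectors between seeds of the
exchange graph. -/
def lengthLattice (n : ℕ) (Δ : Affine.Triangle ℝ Plane) : AddSubgroup ℝ :=
  AddSubgroup.closure {l | ∃ (w : Plane) (s t : mutationClass n Δ),
    (s : Seed) = (t : Seed).translate w ∧ l = ‖w‖}

/-- The translation lattice `L`, as a group of vectors: a real number `l` of `lengthLattice` is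
identified with `l` times the unit vector along the belt line. -/
def translationLattice (n : ℕ) (Δ : Affine.Triangle ℝ Plane) : AddSubgroup Plane :=
  (lengthLattice n Δ).map
    ((LinearMap.toSpanSingleton ℝ Plane (‖beltVector Δ‖⁻¹ • beltVector Δ)).toAddMonoidHom)

/-- `Q` is a quiver on the sides of a triangle or an infinite region with angles `θ`, where `θ i` is
opposite to the side `i`. Its weights are given by the angles, it is acyclic in the acute-angled case
and cyclic in the obtuse-angled case. In the case of an infinite region with finite side `i`, the
arrow between the two sides `i` and `k` of the obtuse angle starts at `i`. -/
structure IsQuiverOf (θ : Fin 3 → ℝ) (Q : Matrix (Fin 3) (Fin 3) ℝ) : Prop where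
  skew : ∀ i j, Q j i = -Q i j
  weight : ∀ i, |Q (i + 1) (i + 2)| = 2 * |Real.cos (θ i)|
  acute : (∀ i, θ i < Real.pi / 2) → IsAcyclic Q
  obtuse : (∃ i, Real.pi / 2 < θ i) → ¬ IsAcyclic Q
  infinite : ∀ i j k, i ≠ j → j ≠ k → i ≠ k → θ i = 0 → Real.pi / 2 < θ j → 0 < Q i k

/-- The vertices of the exchange graph whose triangle (or infinite region) is congruent to the one
given by `D` and whose quiver is `Q`, for some labelling of their sides. -/
def seedsOfShape (n : ℕ) (Δ : Affine.Triangle ℝ Plane) (D : Fin 3 → AffFun)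
    (Q : Matrix (Fin 3) (Fin 3) ℝ) : Set (mutationClass n Δ) :=
  {s | ∃ x : LabelledSeed, (⟦x⟧ : Seed) = s ∧ AreCongruent x.v D ∧ x.B = Q}

end AffineSeed

end

noncomputable section
namespace AffineSeed

/-! ### Affine linear functions and isometries -/

/-! With the belt line as coordinate axis, every seed of Γ turns out to be a standard seed
`Frame.st`. Its angles opposite the sides 0, 1, 2 are A, π - A - C, C with A and C acute, and the
lines of the sides 0 and 2 enclose the angles A and C with the axis. Its quiver has arrows 0 → 1 → 2
and the signed entry -2 cos(A + C) between 0 and 2, so it is cyclic exactly when the middle angle is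
obtuse. Besides the angles A = aα and C = cα there are only a sign ε for the orientation, the point
x where the axis meets side 0, and a size K. The size is read off from the linear relation
`Frame.st_sum` and is the same throughout Γ.

Mutation thus becomes arithmetic on (a, c, ε, x) (`State.mk_seed_mutate`). On cyclic seeds, mutation
at side 0 or 2 replaces a or c by a + c, and mutation at side 1 undoes such a step: this is the
subtractive Euclidean algorithm. On acyclic seeds, mutation at the source reflects the whole
triangle in side 0, rotates the three angles cyclically and reverses ε; mutation at the sink is the
inverse. All this commutes with changing x by a constant and with reversing ε
(`State.mutate_glide`), that is, with translations along the axis and reflection in it. Conversely,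
an unlabelled seed determines its parameters (`State.seed_injective`), and two seeds that are
translates differ by a translation along the axis (`State.seed_translate_eq`). So L corresponds to
the group `State.period` of translations preserving the class.

For the belts: a source mutation strictly lowers x and a sink mutation goes back, while mutation at
the middle vertex makes the quiver cyclic. Hence the source mutations trace a full two-sided
infinite path that no acyclic seed can extend (`exists_belt`), and so do those of any translate by
L.

For the count: angles and quiver fix the pair (a, c) (`IsQuiverOf.exists_perm`), and this pair
occurs because of the gcd condition (`State.occurs_of_gcd_eq_one`). Triangles with equal angles are
congruent since K is the same. There remain the two values of ε, each forming one class modulo L.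
They are exchanged by the glide reflection that arises from three source mutations of the initial
seed (`State.exists_glide`). -/

theorem AffFun.ext_eval {f g : AffFun} (h : ∀ p, f.eval p = g.eval p) : f = g := by
  have h0 : f.2 = g.2 := by simpa [AffFun.eval] using h 0
  refine Prod.ext (ext_inner_right ℝ fun p => ?_) h0
  have := h p
  simp only [AffFun.eval, h0] at this
  linarith

theorem AffFun.move_form (φ : Plane ≃ᵃⁱ[ℝ] Plane) (f g : AffFun) :
    (f.move φ).form (g.move φ) = f.form g := by
  simp [AffFun.move, AffFun.form]

/-! ### Permutations of labels and mutation -/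

theorem LabelledSeed.mk_perm (x : LabelledSeed) (σ : Equiv.Perm (Fin 3)) :
    (⟦x.perm σ⟧ : Seed) = ⟦x⟧ :=
  (Quotient.sound (show x ≈ x.perm σ from ⟨σ, rfl⟩)).symm

theorem LabelledSeed.mk_eq_iff (x y : LabelledSeed) :
    (⟦x⟧ : Seed) = ⟦y⟧ ↔ ∃ σ, y = x.perm σ :=
  Quotient.eq

theorem LabelledSeed.mutate_v_self (pos : Set AffFun) (x : LabelledSeed) (k : Fin 3) :
    (x.mutate pos k).v k = -x.v k := by
  simp [LabelledSeed.mutate]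

/-- The condition for the side `i` to be reflected by the mutation at `k`. -/
def LabelledSeed.Reflects (pos : Set AffFun) (x : LabelledSeed) (k i : Fin 3) : Prop :=
  (x.v k ∈ pos ∧ x.B i k < 0) ∨ (x.v k ∉ pos ∧ 0 < x.B i k)

theorem LabelledSeed.mutate_v_of_reflects {pos : Set AffFun} {x : LabelledSeed} {k i : Fin 3}
    (hi : i ≠ k) (h : x.Reflects pos k i) :
    (x.mutate pos k).v i = x.v i - (x.v i).form (x.v k) • x.v k := by
  rw [LabelledSeed.Reflects] at h
  simp only [LabelledSeed.mutate, hi, if_false, if_pos h]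

theorem LabelledSeed.mutate_v_of_not_reflects {pos : Set AffFun} {x : LabelledSeed} {k i : Fin 3}
    (hi : i ≠ k) (h : ¬ x.Reflects pos k i) : (x.mutate pos k).v i = x.v i := by
  rw [LabelledSeed.Reflects] at h
  simp only [LabelledSeed.mutate, hi, if_false, if_neg h]

/-- Relabelling only renames the direction of mutation, so computations may be made with any
convenient representative of a seed. -/
theorem LabelledSeed.perm_mutate (pos : Set AffFun) (x : LabelledSeed) (σ : Equiv.Perm (Fin 3))
    (k : Fin 3) : (x.perm σ).mutate pos k = (x.mutate pos (σ k)).perm σ := by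
  refine LabelledSeed.ext (funext fun i => ?_) ?_
  · by_cases hi : i = k
    · subst hi
      rw [mutate_v_self]
      exact (mutate_v_self pos x (σ i)).symm
    · have hi' : σ i ≠ σ k := fun h => hi (σ.injective h)
      have hr : (x.perm σ).Reflects pos k i ↔ x.Reflects pos (σ k) (σ i) := Iff.rfl
      change _ = (x.mutate pos (σ k)).v (σ i)
      by_cases h : x.Reflects pos (σ k) (σ i)
      · rw [mutate_v_of_reflects hi (hr.2 h), mutate_v_of_reflects hi' h]
        rfl
      · rw [mutate_v_of_not_reflects hi (mt hr.1 h), mutate_v_of_not_reflects hi' h]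
        rfl
  · ext i j
    simp [LabelledSeed.mutate, LabelledSeed.perm, mutateMatrix]

theorem mutateMatrix_mutateMatrix (B : Matrix (Fin 3) (Fin 3) ℝ) (k : Fin 3) :
    mutateMatrix (mutateMatrix B k) k = B := by
  ext i j
  simp only [mutateMatrix]
  by_cases h : k = i ∨ k = j
  · simp [h]
  · simp [h]
    ring

theorem AffFun.form_self_reflect {f g : AffFun} (hg : g.form g = 2) :
    (f - f.form g • g) - (f - f.form g • g).form (-g) • (-g) = f := by
  have : (f - f.form g • g).form (-g) = f.form g := by
    simp only [AffFun.form] at hg ⊢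
    simp only [Prod.fst_sub, Prod.smul_fst, Prod.fst_neg, inner_neg_right, inner_sub_left,
      real_inner_smul_left, hg]
    ring
  rw [this]
  simp

/-- Mutation is an involution at a vertex whose line is not the belt line. -/
theorem LabelledSeed.mutate_mutate {pos : Set AffFun} {x : LabelledSeed} {k : Fin 3}
    (hk : (x.v k).form (x.v k) = 2) (hpos : -x.v k ∈ pos ↔ x.v k ∉ pos) :
    (x.mutate pos k).mutate pos k = x := by
  refine LabelledSeed.ext (funext fun i => ?_) (mutateMatrix_mutateMatrix x.B k)
  by_cases hi : i = k
  · subst hi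
    rw [mutate_v_self, mutate_v_self, neg_neg]
  -- The first mutation reverses both the positivity of the vector at `k` and the signs of the
  -- entries in column `k`, so the second one reflects the same sides.
  · have hc : (x.mutate pos k).Reflects pos k i ↔ x.Reflects pos k i := by
      simp only [Reflects, LabelledSeed.mutate, mutateMatrix, if_true,
        or_true, hpos, Left.neg_neg_iff, Left.neg_pos_iff]
      tauto
    by_cases h : x.Reflects pos k i
    · rw [mutate_v_of_reflects hi (hc.2 h), mutate_v_of_reflects hi h, mutate_v_self]
      exact AffFun.form_self_reflect hk
    · rw [mutate_v_of_not_reflects hi (mt hc.1 h), mutate_v_of_not_reflects hi h]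

/-! ### Coordinates adapted to a directed line -/

/-- A Cartesian coordinate system of the plane. -/
structure Frame where
  /-- the origin -/
  O : Plane
  /-- the coordinate directions -/
  b : OrthonormalBasis (Fin 2) ℝ Plane

namespace Frame

variable (F : Frame)

/-- The point with given coordinates. -/
def pt (r s : ℝ) : Plane := F.O + (r • F.b 0 + s • F.b 1)

/-- `√2` times the affine linear function `(r, s) ↦ X r + Y s + Z`. -/
def fn (X Y Z : ℝ) : AffFun :=
  (√2 • (X • F.b 0 + Y • F.b 1), √2 * Z - inner ℝ (√2 • (X • F.b 0 + Y • F.b 1)) F.O)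

theorem inner_b (X Y X' Y' : ℝ) :
    inner ℝ (X • F.b 0 + Y • F.b 1) (X' • F.b 0 + Y' • F.b 1) = X * X' + Y * Y' := by
  have h := F.b.orthonormal
  have h00 : inner ℝ (F.b 0) (F.b 0) = 1 := by simp
  have h11 : inner ℝ (F.b 1) (F.b 1) = 1 := by simp
  have h01 : inner ℝ (F.b 0) (F.b 1) = 0 := h.2 (by decide)
  have h10 : inner ℝ (F.b 1) (F.b 0) = 0 := h.2 (by decide)
  simp only [inner_add_left, inner_add_right, real_inner_smul_left, real_inner_smul_right,
    h00, h11, h01, h10]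
  ring

theorem vec_eq (w : Plane) : w = inner ℝ (F.b 0) w • F.b 0 + inner ℝ (F.b 1) w • F.b 1 := by
  conv_lhs => rw [← F.b.sum_repr' w]
  simp [Fin.sum_univ_two]

theorem exists_pt (p : Plane) : ∃ r s, p = F.pt r s :=
  ⟨_, _, by rw [pt, ← F.vec_eq (p - F.O)]; simp⟩

theorem eval_fn (X Y Z r s : ℝ) :
    (F.fn X Y Z).eval (F.pt r s) = √2 * (X * r + Y * s + Z) := by
  simp only [fn, AffFun.eval, pt, inner_add_right, real_inner_smul_left]
  have := F.inner_b X Y r s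
  simp only [inner_add_right] at this
  linear_combination √2 * this

theorem sqrt_two_ne_zero : (√2 : ℝ) ≠ 0 := by positivity

theorem fn_inj {X Y Z X' Y' Z' : ℝ} :
    F.fn X Y Z = F.fn X' Y' Z' ↔ X = X' ∧ Y = Y' ∧ Z = Z' := by
  refine ⟨fun h => ?_, by rintro ⟨rfl, rfl, rfl⟩; rfl⟩
  have e (r s : ℝ) : X * r + Y * s + Z = X' * r + Y' * s + Z' := by
    have := congrArg (fun f => AffFun.eval f (F.pt r s)) h
    simpa only [eval_fn, mul_eq_mul_left_iff, sqrt_two_ne_zero, or_false] using this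
  have h0 := e 0 0
  have h1 := e 1 0
  have h2 := e 0 1
  refine ⟨?_, ?_, ?_⟩ <;> linarith

theorem fn_neg (X Y Z : ℝ) : -F.fn X Y Z = F.fn (-X) (-Y) (-Z) := by
  refine Prod.ext ?_ ?_
  · simp only [fn, Prod.fst_neg]; module
  · simp only [fn, Prod.snd_neg, real_inner_smul_left, inner_add_left]; ring

theorem fn_add (X Y Z X' Y' Z' : ℝ) :
    F.fn X Y Z + F.fn X' Y' Z' = F.fn (X + X') (Y + Y') (Z + Z') := by
  refine Prod.ext ?_ ?_
  · simp only [fn, Prod.fst_add]; module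
  · simp only [fn, Prod.snd_add, real_inner_smul_left, inner_add_left]; ring

theorem fn_smul (t X Y Z : ℝ) : t • F.fn X Y Z = F.fn (t * X) (t * Y) (t * Z) := by
  refine Prod.ext ?_ ?_
  · simp only [fn, Prod.smul_fst]; module
  · simp only [fn, Prod.smul_snd, real_inner_smul_left, inner_add_left, smul_eq_mul]; ring

theorem fn_sub_smul (t X Y Z X' Y' Z' : ℝ) :
    F.fn X Y Z - t • F.fn X' Y' Z' = F.fn (X - t * X') (Y - t * Y') (Z - t * Z') := by
  rw [sub_eq_add_neg, fn_smul, fn_neg, fn_add]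
  simp only [sub_eq_add_neg]

theorem form_fn (X Y Z X' Y' Z' : ℝ) :
    (F.fn X Y Z).form (F.fn X' Y' Z') = 2 * (X * X' + Y * Y') := by
  have h : √2 * √2 = (2 : ℝ) := Real.mul_self_sqrt (by norm_num)
  simp only [fn, AffFun.form, real_inner_smul_left, real_inner_smul_right, inner_b]
  rw [← mul_assoc, h]

/-- Positivity with respect to the point at infinity of the first coordinate axis. -/
def pos : Set AffFun :=
  {f | ∀ᶠ t : ℝ in Filter.atTop, F.pt t 0 ∈ f.halfPlane}

/-- Far out on the axis the coefficient `X` decides; for a line parallel to the axis the constant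
`Z` does. -/
theorem fn_mem_pos {X Y Z : ℝ} : F.fn X Y Z ∈ F.pos ↔ X < 0 ∨ X = 0 ∧ Z < 0 := by
  have hs : (0 : ℝ) < √2 := by positivity
  have key (t : ℝ) : F.pt t 0 ∈ (F.fn X Y Z).halfPlane ↔ X * t + Z < 0 := by
    rw [AffFun.halfPlane, Set.mem_ofPred_eq, eval_fn, mul_zero, add_zero]
    constructor
    · intro h; by_contra h'; push Not at h'; nlinarith [mul_nonneg hs.le h']
    · intro h; nlinarith
  simp only [pos, Set.mem_ofPred_eq, key]
  rcases lt_trichotomy X 0 with h | h | h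
  · refine ⟨fun _ => Or.inl h, fun _ => ?_⟩
    filter_upwards [Filter.eventually_gt_atTop (Z / (-X))] with t ht
    rw [div_lt_iff₀ (by linarith)] at ht
    linarith
  · simp only [h, zero_mul, zero_add, lt_self_iff_false, true_and, false_or,
      Filter.eventually_const]
  · constructor
    · intro h'
      obtain ⟨t, h1, h2⟩ := (h'.and (Filter.eventually_gt_atTop (-Z / X))).exists
      rw [div_lt_iff₀ h] at h2
      nlinarith
    · rintro (h' | ⟨h', -⟩) <;> linarith

/-- The hypothesis excludes exactly the axis itself, for which neither of the two opposite functions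
is positive. -/
theorem neg_fn_mem_pos {X Y Z : ℝ} (h : X ≠ 0 ∨ Z ≠ 0) :
    -F.fn X Y Z ∈ F.pos ↔ F.fn X Y Z ∉ F.pos := by
  rw [fn_neg, fn_mem_pos, fn_mem_pos]
  rcases lt_trichotomy X 0 with h1 | h1 | h1
  · simp [h1, h1.ne, h1.le]
  · subst h1
    have h : Z ≠ 0 := by simpa using h
    rcases lt_or_gt_of_ne h with h | h <;> simp [h, h.le]
  · simp [h1, h1.ne', h1.le]

theorem fn_translate (w X Y Z s : ℝ) :
    (F.fn X Y Z).move (AffineIsometryEquiv.constVAdd ℝ Plane (w • F.b 0 + s • F.b 1)) =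
      F.fn X Y (Z - w * X - s * Y) := by
  refine AffFun.ext_eval fun p => ?_
  obtain ⟨r, t, rfl⟩ := F.exists_pt p
  have : (AffineIsometryEquiv.constVAdd ℝ Plane (w • F.b 0 + s • F.b 1)).symm (F.pt r t) =
      F.pt (r - w) (t - s) := by
    rw [AffineIsometryEquiv.symm_apply_eq]
    simp only [AffineIsometryEquiv.coe_constVAdd, vadd_eq_add, pt]
    module
  rw [AffFun.eval_move, this, eval_fn, eval_fn]
  ring

/-- The first coordinate axis. -/
def axis : AffineSubspace ℝ Plane := AffineSubspace.mk' F.O (Submodule.span ℝ {F.b 0})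

theorem fn_reflect (s : AffineSubspace ℝ Plane) [Nonempty s] (hs : s = F.axis) (X Y Z : ℝ) :
    (F.fn X Y Z).move (EuclideanGeometry.reflection s) = F.fn X (-Y) Z := by
  refine AffFun.ext_eval fun p => ?_
  obtain ⟨r, t, rfl⟩ := F.exists_pt p
  have h01 : inner ℝ (F.b 0) (F.b 1) = 0 := F.b.orthonormal.2 (by decide)
  have : (EuclideanGeometry.reflection s) (F.pt r t) = F.pt r (-t) := by
    have h1 : F.O + r • F.b 0 ∈ s := by
      rw [hs, axis, AffineSubspace.mem_mk']
      simpa using Submodule.smul_mem _ r (Submodule.mem_span_singleton_self _)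
    have h2 : t • F.b 1 ∈ s.directionᗮ := by
      rw [hs, axis, AffineSubspace.direction_mk']
      refine Submodule.smul_mem _ t ?_
      rw [Submodule.mem_orthogonal_singleton_iff_inner_right]
      exact h01
    have := EuclideanGeometry.reflection_orthogonal_vadd h1 h2
    simp only [vadd_eq_add] at this
    rw [show F.pt r t = t • F.b 1 + (F.O + r • F.b 0) by simp only [pt]; module, this]
    simp only [pt]; module
  rw [AffFun.eval_move, EuclideanGeometry.reflection_symm, this, eval_fn, eval_fn]
  ring

end Frame

/-- The skew-symmetric matrix with given entries above the diagonal. -/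
def skew (p q r : ℝ) : Matrix (Fin 3) (Fin 3) ℝ := !![0, p, r; -p, 0, q; -r, -q, 0]

theorem skew_skew (p q r : ℝ) (i j : Fin 3) : skew p q r j i = -skew p q r i j := by
  fin_cases i <;> fin_cases j <;> simp [skew]

theorem mutateMatrix_skew_zero_of_neg {p q r : ℝ} (hp : 0 < p) (hr : r < 0) :
    mutateMatrix (skew p q r) 0 = skew (-p) (q + p * r) (-r) := by
  ext i j
  fin_cases i <;> fin_cases j <;>
    simp [mutateMatrix, skew, abs_of_pos hp, abs_of_neg hr]
  ring

theorem mutateMatrix_skew_zero_of_pos {p q r : ℝ} (hp : 0 < p) (hr : 0 < r) :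
    mutateMatrix (skew p q r) 0 = skew (-p) q (-r) := by
  ext i j
  fin_cases i <;> fin_cases j <;>
    simp [mutateMatrix, skew, abs_of_pos hp, abs_of_pos hr]

theorem mutateMatrix_skew_two_of_neg {p q r : ℝ} (hq : 0 < q) (hr : r < 0) :
    mutateMatrix (skew p q r) 2 = skew (p + q * r) (-q) (-r) := by
  ext i j
  fin_cases i <;> fin_cases j <;>
    simp [mutateMatrix, skew, abs_of_pos hq, abs_of_neg hr] <;> ring

/-- The cyclic permutation `0 ↦ 2 ↦ 1 ↦ 0`. -/
def rot : Equiv.Perm (Fin 3) := (finRotate 3)⁻¹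

/-! ### Standard seeds along an axis and their mutations -/

namespace Frame

variable (F : Frame)

/-- The standard seed with angles `A`, `π - A - C` and `C`. The belt line enters through the side
`0` and leaves through the side `2`, with which it encloses the angles `A` and `C`. -/
def st (K A C ε x : ℝ) : LabelledSeed where
  v := ![F.fn (-Real.sin A) (ε * Real.cos A) (x * Real.sin A),
    F.fn (Real.sin (A - C)) (-(ε * Real.cos (A - C)))
      (-(x * Real.sin (A - C)) - K * Real.cos C / Real.sin A),
    F.fn (Real.sin C) (ε * Real.cos C) (-(x * Real.sin C) + K * Real.cos (A + C) / Real.sin A)]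
  B := skew (2 * Real.cos C) (2 * Real.cos A) (-(2 * Real.cos (A + C)))

/-- The displacement of a seed under mutation at the side `0`. -/
def shift (K A C : ℝ) : ℝ := K * Real.cos C / (Real.sin A * Real.sin (A + C))

variable {F} {K A C ε x : ℝ}

theorem st_v_zero : (F.st K A C ε x).v 0 =
    F.fn (-Real.sin A) (ε * Real.cos A) (x * Real.sin A) := rfl

theorem st_v_one : (F.st K A C ε x).v 1 =
    F.fn (Real.sin (A - C)) (-(ε * Real.cos (A - C)))
      (-(x * Real.sin (A - C)) - K * Real.cos C / Real.sin A) := rfl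

theorem st_v_two : (F.st K A C ε x).v 2 =
    F.fn (Real.sin C) (ε * Real.cos C)
      (-(x * Real.sin C) + K * Real.cos (A + C) / Real.sin A) := rfl

theorem st_B : (F.st K A C ε x).B =
    skew (2 * Real.cos C) (2 * Real.cos A) (-(2 * Real.cos (A + C))) := rfl

theorem st_form_self (hε : ε ^ 2 = 1) (i : Fin 3) :
    ((F.st K A C ε x).v i).form ((F.st K A C ε x).v i) = 2 := by
  have h1 := Real.sin_sq_add_cos_sq A
  have h2 := Real.sin_sq_add_cos_sq (A - C)
  have h3 := Real.sin_sq_add_cos_sq C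
  fin_cases i
  · change ((F.st K A C ε x).v 0).form ((F.st K A C ε x).v 0) = 2
    rw [st_v_zero, form_fn]
    linear_combination 2 * h1 + 2 * Real.cos A ^ 2 * hε
  · change ((F.st K A C ε x).v 1).form ((F.st K A C ε x).v 1) = 2
    rw [st_v_one, form_fn]
    linear_combination 2 * h2 + 2 * Real.cos (A - C) ^ 2 * hε
  · change ((F.st K A C ε x).v 2).form ((F.st K A C ε x).v 2) = 2
    rw [st_v_two, form_fn]
    linear_combination 2 * h3 + 2 * Real.cos C ^ 2 * hε

theorem st_form_one_zero (hε : ε ^ 2 = 1) :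
    ((F.st K A C ε x).v 1).form ((F.st K A C ε x).v 0) = -(2 * Real.cos C) := by
  rw [st_v_zero, st_v_one, form_fn, show Real.cos C = Real.cos (A - (A - C)) by congr 1; ring,
    Real.cos_sub A (A - C)]
  linear_combination -2 * Real.cos A * Real.cos (A - C) * hε

theorem st_form_two_zero (hε : ε ^ 2 = 1) :
    ((F.st K A C ε x).v 2).form ((F.st K A C ε x).v 0) = 2 * Real.cos (A + C) := by
  rw [st_v_zero, st_v_two, form_fn, Real.cos_add]
  linear_combination 2 * Real.cos A * Real.cos C * hε

theorem st_form_one_two (hε : ε ^ 2 = 1) :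
    ((F.st K A C ε x).v 1).form ((F.st K A C ε x).v 2) = -(2 * Real.cos A) := by
  rw [st_v_two, st_v_one, form_fn, show Real.cos A = Real.cos ((A - C) + C) by congr 1; ring,
    Real.cos_add (A - C) C]
  linear_combination -2 * Real.cos C * Real.cos (A - C) * hε

theorem st_zero_mem_pos (hA : 0 < Real.sin A) : (F.st K A C ε x).v 0 ∈ F.pos := by
  rw [st_v_zero, fn_mem_pos]
  left; linarith

theorem st_two_not_mem_pos (hK : 0 < K) (hA : 0 < Real.sin A) (hA' : 0 < Real.cos A)
    (hC : 0 < Real.sin C ∨ C = 0) : (F.st K A C ε x).v 2 ∉ F.pos := by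
  rw [st_v_two, fn_mem_pos]
  rcases hC with hC | rfl
  · push Not
    exact ⟨hC.le, fun h => absurd h hC.ne'⟩
  -- For `C = 0` side 2 is parallel to the axis and positivity is decided by its constant term,
  -- which is positive because `A` is acute.
  · have : 0 < K * Real.cos A / Real.sin A := by positivity
    simp [this.le]

/-- No side of a standard seed lies on the belt line. -/
theorem st_neg_mem_pos (hK : 0 < K) (hA : 0 < Real.sin A) (hA' : 0 < Real.cos A)
    (hC' : 0 < Real.cos C) (hC : 0 < Real.sin C ∨ C = 0) (k : Fin 3) :
    -(F.st K A C ε x).v k ∈ F.pos ↔ (F.st K A C ε x).v k ∉ F.pos := by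
  fin_cases k
  · exact neg_fn_mem_pos _ (.inl (by linarith))
  · refine neg_fn_mem_pos _ ?_
    -- If this sine vanishes, side 1 is parallel to the axis, but its constant term keeps it off the
    -- axis.
    by_cases h : Real.sin (A - C) = 0
    · right
      rw [h]
      have : 0 < K * Real.cos C / Real.sin A := by positivity
      intro h'
      linarith
    · exact .inl h
  · refine neg_fn_mem_pos _ ?_
    rcases hC with hC | rfl
    · exact .inl hC.ne'
    · right
      have : 0 < K * Real.cos A / Real.sin A := by positivity
      simpa using this.ne'

/-- In the cyclic case only side 1 receives an arrow from 0. Its mirror image in side 0 becomes the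
new entry side and the reversed side 0 becomes the middle one. The angles are then A + C, π - A -
2C, C. -/
theorem st_mutate_zero_of_pos (hε : ε ^ 2 = 1) (hA : 0 < Real.sin A) (hC : 0 < Real.cos C)
    (hS : 0 < Real.sin (A + C)) (h : 0 < Real.cos (A + C)) :
    (F.st K A C ε x).mutate F.pos 0 =
      (F.st K (A + C) C ε (x - shift K A C)).perm (Equiv.swap 0 1) := by
  have hp := st_zero_mem_pos (F := F) (K := K) (C := C) (ε := ε) (x := x) hA
  refine LabelledSeed.ext (funext fun i => ?_) ?_
  · fin_cases i
    · change ((F.st K A C ε x).mutate F.pos 0).v 0 = (F.st K (A + C) C ε _).v (Equiv.swap 0 1 0)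
      rw [LabelledSeed.mutate_v_self, Equiv.swap_apply_left, st_v_one, st_v_zero, fn_neg, fn_inj,
        add_sub_cancel_right]
      refine ⟨by ring, by ring, ?_⟩
      rw [shift]
      field_simp
      ring
    · change ((F.st K A C ε x).mutate F.pos 0).v 1 = (F.st K (A + C) C ε _).v (Equiv.swap 0 1 1)
      rw [LabelledSeed.mutate_v_of_reflects (by decide) (.inl ⟨hp, by simp [st_B, skew, hC]⟩),
        st_form_one_zero hε, Equiv.swap_apply_right, st_v_one, st_v_zero, st_v_zero, fn_sub_smul,
        fn_inj, Real.sin_sub, Real.cos_sub, Real.cos_add, shift]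
      refine ⟨?_, ?_, ?_⟩
      · rw [Real.sin_add]; ring
      · ring
      · field_simp
        rw [Real.sin_add]; ring
    · change ((F.st K A C ε x).mutate F.pos 0).v 2 = (F.st K (A + C) C ε _).v (Equiv.swap 0 1 2)
      rw [LabelledSeed.mutate_v_of_not_reflects (by decide) (by
          simp [LabelledSeed.Reflects, hp, st_B, skew, h.le]),
        Equiv.swap_apply_of_ne_of_ne (by decide) (by decide), st_v_two, st_v_two, fn_inj]
      refine ⟨rfl, rfl, ?_⟩
      rw [shift, Real.cos_add (A + C) C]
      have h1 : Real.cos A = Real.cos (A + C) * Real.cos C + Real.sin (A + C) * Real.sin C := by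
        rw [← Real.cos_sub, add_sub_cancel_right]
      have h2 : Real.sin A = Real.sin (A + C) * Real.cos C - Real.cos (A + C) * Real.sin C := by
        rw [← Real.sin_sub, add_sub_cancel_right]
      have h3 := Real.sin_sq_add_cos_sq C
      field_simp
      rw [h2]
      linear_combination (-K * Real.sin (A + C) * Real.cos (A + C)) * h3 +
        K * Real.sin C * Real.cos C * Real.sin_sq_add_cos_sq (A + C)
  · change mutateMatrix (skew _ _ _) 0 = (skew _ _ _).submatrix _ _
    rw [mutateMatrix_skew_zero_of_neg (by linarith) (by linarith)]
    have h1 : Real.cos A = Real.cos (A + C) * Real.cos C + Real.sin (A + C) * Real.sin C := by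
      rw [← Real.cos_sub, add_sub_cancel_right]
    have e : 2 * Real.cos A + 2 * Real.cos C * -(2 * Real.cos (A + C)) =
        -(2 * Real.cos (A + C + C)) := by
      rw [h1, Real.cos_add (A + C) C]; ring
    rw [e]
    ext i j
    fin_cases i <;> fin_cases j <;> simp [skew, Equiv.swap_apply_of_ne_of_ne]

/-- This is the mirror situation at the exit: side 2 is not positive, so the side 1 with an arrow to
2 is reflected, and it becomes the new exit side. The entry side, and with it `x`, stays. -/
theorem st_mutate_two_of_pos (hε : ε ^ 2 = 1) (hA : 0 < Real.sin A) (hA' : 0 < Real.cos A)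
    (hp : (F.st K A C ε x).v 2 ∉ F.pos) (h : 0 < Real.cos (A + C)) :
    (F.st K A C ε x).mutate F.pos 2 = (F.st K A (A + C) ε x).perm (Equiv.swap 1 2) := by
  refine LabelledSeed.ext (funext fun i => ?_) ?_
  · fin_cases i
    · change ((F.st K A C ε x).mutate F.pos 2).v 0 = (F.st K A (A + C) ε _).v (Equiv.swap 1 2 0)
      rw [LabelledSeed.mutate_v_of_not_reflects (by decide) (by
          simp [LabelledSeed.Reflects, hp, st_B, skew, h.le]),
        Equiv.swap_apply_of_ne_of_ne (by decide) (by decide), st_v_zero, st_v_zero]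
    · change ((F.st K A C ε x).mutate F.pos 2).v 1 = (F.st K A (A + C) ε _).v (Equiv.swap 1 2 1)
      rw [LabelledSeed.mutate_v_of_reflects (by decide) (.inr ⟨hp, by simp [st_B, skew, hA']⟩),
        st_form_one_two hε, Equiv.swap_apply_left, st_v_one, st_v_two, st_v_two, fn_sub_smul,
        fn_inj, Real.cos_add A (A + C), Real.sin_sub, Real.cos_sub, Real.sin_add, Real.cos_add]
      have h3 := Real.sin_sq_add_cos_sq A
      refine ⟨?_, ?_, ?_⟩
      · ring
      · ring
      · field_simp
        linear_combination (K * Real.cos C ) * h3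
    · change ((F.st K A C ε x).mutate F.pos 2).v 2 = (F.st K A (A + C) ε _).v (Equiv.swap 1 2 2)
      rw [LabelledSeed.mutate_v_self, Equiv.swap_apply_right, st_v_one, st_v_two, fn_neg, fn_inj,
        sub_add_cancel_left, Real.sin_neg, Real.cos_neg]
      refine ⟨by ring, by ring, by ring⟩
  · change mutateMatrix (skew _ _ _) 2 = (skew _ _ _).submatrix _ _
    rw [mutateMatrix_skew_two_of_neg (by linarith) (by linarith)]
    have h1 : Real.cos C = Real.cos (A + C) * Real.cos A + Real.sin (A + C) * Real.sin A := by
      rw [← Real.cos_sub, add_sub_cancel_left]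
    have e : 2 * Real.cos C + 2 * Real.cos A * -(2 * Real.cos (A + C)) =
        -(2 * Real.cos (A + (A + C))) := by
      rw [h1, Real.cos_add A (A + C)]; ring
    rw [e]
    ext i j
    fin_cases i <;> fin_cases j <;> simp [skew, Equiv.swap_apply_of_ne_of_ne]

/-- In the acyclic case 0 is a source and both other sides are reflected, so the whole triangle is
reflected in side 0. The axis now leaves through this side, enters through the image of side 1, and
sees the opposite orientation. -/
theorem st_mutate_zero_of_neg (hε : ε ^ 2 = 1) (hA : 0 < Real.sin A) (hC : 0 < Real.cos C)
    (hS : 0 < Real.sin (A + C)) (h : Real.cos (A + C) < 0) :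
    (F.st K A C ε x).mutate F.pos 0 =
      (F.st K (Real.pi - (A + C)) A (-ε) (x - shift K A C)).perm rot := by
  have hp := st_zero_mem_pos (F := F) (K := K) (C := C) (ε := ε) (x := x) hA
  have hC1 : Real.cos C = Real.cos (A + C) * Real.cos A + Real.sin (A + C) * Real.sin A := by
    rw [← Real.cos_sub, add_sub_cancel_left]
  have hC2 : Real.sin C = Real.sin (A + C) * Real.cos A - Real.cos (A + C) * Real.sin A := by
    rw [← Real.sin_sub, add_sub_cancel_left]
  have h3 := Real.sin_sq_add_cos_sq A
  refine LabelledSeed.ext (funext fun i => ?_) ?_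
  · fin_cases i
    · change ((F.st K A C ε x).mutate F.pos 0).v 0 = (F.st K _ A (-ε) _).v 2
      rw [LabelledSeed.mutate_v_self, st_v_zero, st_v_two, fn_neg, fn_inj,
        show Real.pi - (A + C) + A = Real.pi - C by ring, Real.cos_pi_sub, Real.sin_pi_sub, shift]
      refine ⟨by ring, by ring, ?_⟩
      field_simp
      ring
    · change ((F.st K A C ε x).mutate F.pos 0).v 1 = (F.st K _ A (-ε) _).v 0
      rw [LabelledSeed.mutate_v_of_reflects (by decide) (.inl ⟨hp, by simp [st_B, skew, hC]⟩),
        st_form_one_zero hε, st_v_one, st_v_zero, st_v_zero, fn_sub_smul,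
        fn_inj, Real.cos_pi_sub, Real.sin_pi_sub, Real.sin_sub, Real.cos_sub, Real.cos_add, shift]
      refine ⟨?_, ?_, ?_⟩
      · rw [Real.sin_add]; ring
      · ring
      · field_simp
        rw [Real.sin_add]; ring
    · change ((F.st K A C ε x).mutate F.pos 0).v 2 = (F.st K _ A (-ε) _).v 1
      rw [LabelledSeed.mutate_v_of_reflects (by decide) (.inl ⟨hp, by
          change -(-(2 * Real.cos (A + C))) < 0; linarith⟩),
        st_form_two_zero hε, st_v_two, st_v_zero, st_v_one, fn_sub_smul,
        fn_inj, show Real.pi - (A + C) - A = Real.pi - (A + (A + C)) by ring, Real.cos_pi_sub,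
        Real.sin_pi_sub, Real.sin_pi_sub, shift, Real.sin_add A (A + C), Real.cos_add A (A + C)]
      refine ⟨?_, ?_, ?_⟩
      · rw [hC2]; ring
      · rw [hC1]; ring
      · field_simp
        rw [hC1, hC2]
        linear_combination (-K * Real.sin (A + C) * Real.cos (A + C)) * h3 -
          K * Real.sin A * Real.cos A * Real.sin_sq_add_cos_sq (A + C)
  · change mutateMatrix (skew _ _ _) 0 = (skew _ _ _).submatrix _ _
    rw [mutateMatrix_skew_zero_of_pos (by linarith) (by linarith),
      show Real.pi - (A + C) + A = Real.pi - C by ring, Real.cos_pi_sub, Real.cos_pi_sub]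
    have r0 : rot 0 = 2 := rfl
    have r1 : rot 1 = 0 := rfl
    have r2 : rot 2 = 1 := rfl
    ext i j
    fin_cases i <;> fin_cases j <;> simp [skew, r0, r1, r2]

/-- A standard seed is determined, including its labels, by the angles and the quiver. -/
theorem st_perm_eq {A' C' ε' x' : ℝ} {σ : Equiv.Perm (Fin 3)} (hε : ε ^ 2 = 1) (hε' : ε' ^ 2 = 1)
    (hA : 0 < Real.cos A) (hC : 0 < Real.cos C) (hA' : 0 < Real.cos A') (hC' : 0 < Real.cos C')
    (hform : ∀ i j, ((F.st K A' C' ε' x').v i).form ((F.st K A' C' ε' x').v j) =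
      ((F.st K A C ε x).v (σ i)).form ((F.st K A C ε x).v (σ j)))
    (hB : (F.st K A' C' ε' x').B = (F.st K A C ε x).B.submatrix σ σ) :
    σ = 1 ∧ Real.cos A' = Real.cos A ∧ Real.cos C' = Real.cos C := by
  have f10 := hform 1 0
  have f20 := hform 2 0
  have f12 := hform 1 2
  rw [st_form_one_zero hε'] at f10
  rw [st_form_two_zero hε'] at f20
  rw [st_form_one_two hε'] at f12
  have b01 := congrFun (congrFun hB 0) 1
  have b12 := congrFun (congrFun hB 1) 2
  have b02 := congrFun (congrFun hB 0) 2
  simp only [st_B, skew, Matrix.submatrix_apply] at b01 b12 b02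
  have g10 := st_form_one_zero (F := F) (K := K) (A := A) (C := C) (x := x) hε
  have g20 := st_form_two_zero (F := F) (K := K) (A := A) (C := C) (x := x) hε
  have g12 := st_form_one_two (F := F) (K := K) (A := A) (C := C) (x := x) hε
  have comm (f g : AffFun) : f.form g = g.form f := real_inner_comm _ _
  have g01 := g10; have g02 := g20; have g21 := g12
  rw [comm] at g01 g02 g21
  -- In a standard seed the matrix entry is minus the scalar product at every pair i < j. A pair
  -- whose order `σ` reverses would therefore have product zero. Every `σ ≠ 1` reverses 0, 1 or 1,
  -- 2, where the product is -2 cos C' or -2 cos A', which is nonzero.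
  have key : ∀ σ : Equiv.Perm (Fin 3), σ = 1 ∨ ((σ 0, σ 1, σ 2) = (0, 2, 1) ∨
    (σ 0, σ 1, σ 2) = (1, 0, 2) ∨ (σ 0, σ 1, σ 2) = (1, 2, 0) ∨ (σ 0, σ 1, σ 2) = (2, 0, 1) ∨
    (σ 0, σ 1, σ 2) = (2, 1, 0)) := by decide
  rcases key σ with rfl | h | h | h | h | h
  · refine ⟨rfl, ?_, ?_⟩
    · simp at b12; exact b12
    · simp at b01; exact b01
  all_goals
    simp only [Prod.mk.injEq] at h
    obtain ⟨h0, h1, h2⟩ := h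
    simp only [h0, h1, h2, g10, g20, g12, g01, g02, g21] at f10 f20 f12
    simp [h0, h1, h2] at b01 b12 b02
    exfalso
    linarith

end Frame

/-! ### Trigonometry of the multiples of the fundamental angle -/

section Trig

variable {n k : ℕ}

theorem fundAngle_pos (n : ℕ) : 0 < fundAngle n := by
  have := Real.pi_pos
  unfold fundAngle
  positivity

theorem mul_fundAngle (n : ℕ) : (2 * n + 1) * fundAngle n = Real.pi := by
  unfold fundAngle
  field_simp

theorem sin_mul_fundAngle_pos (h : 1 ≤ k) (h' : k ≤ 2 * n) : 0 < Real.sin (k * fundAngle n) := by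
  have hα := fundAngle_pos n
  have hπ := mul_fundAngle n
  have h1 : (1 : ℝ) ≤ k := by exact_mod_cast h
  have h2 : (k : ℝ) ≤ 2 * n := by exact_mod_cast h'
  apply Real.sin_pos_of_pos_of_lt_pi <;> nlinarith

theorem mul_fundAngle_lt_half_pi (h : k ≤ n) : k * fundAngle n < Real.pi / 2 := by
  have hα := fundAngle_pos n
  have hπ := mul_fundAngle n
  have h2 : (k : ℝ) ≤ n := by exact_mod_cast h
  nlinarith

theorem half_pi_lt_mul_fundAngle (h : n + 1 ≤ k) : Real.pi / 2 < k * fundAngle n := by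
  have hα := fundAngle_pos n
  have hπ := mul_fundAngle n
  have h2 : (n : ℝ) + 1 ≤ k := by exact_mod_cast h
  nlinarith

theorem mul_fundAngle_nonneg (n k : ℕ) : 0 ≤ k * fundAngle n := by
  have hα := fundAngle_pos n
  positivity

theorem mul_fundAngle_le_pi (h : k ≤ 2 * n + 1) : k * fundAngle n ≤ Real.pi := by
  have hα := fundAngle_pos n
  have hπ := mul_fundAngle n
  have h2 : (k : ℝ) ≤ 2 * n + 1 := by exact_mod_cast h
  nlinarith

theorem cos_mul_fundAngle_pos (h : k ≤ n) : 0 < Real.cos (k * fundAngle n) := by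
  have h1 := mul_fundAngle_lt_half_pi h
  have h2 := mul_fundAngle_nonneg n k
  apply Real.cos_pos_of_mem_Ioo
  constructor <;> linarith [Real.pi_pos]

theorem cos_mul_fundAngle_neg (h : n + 1 ≤ k) (h' : k ≤ 2 * n + 1) :
    Real.cos (k * fundAngle n) < 0 := by
  have h1 := half_pi_lt_mul_fundAngle h
  have h2 := mul_fundAngle_le_pi h'
  apply Real.cos_neg_of_pi_div_two_lt_of_lt h1
  linarith [Real.pi_pos]

theorem cos_mul_fundAngle_inj {j : ℕ} (hj : j ≤ 2 * n + 1) (hk : k ≤ 2 * n + 1)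
    (h : Real.cos (j * fundAngle n) = Real.cos (k * fundAngle n)) : j = k := by
  have := Real.injOn_cos ⟨mul_fundAngle_nonneg n j, mul_fundAngle_le_pi hj⟩
    ⟨mul_fundAngle_nonneg n k, mul_fundAngle_le_pi hk⟩ h
  have := mul_right_cancel₀ (fundAngle_pos n).ne' this
  exact_mod_cast this

theorem sub_mul_fundAngle {k : ℕ} (h : k ≤ 2 * n + 1) :
    ((2 * n + 1 - k : ℕ) : ℝ) * fundAngle n = Real.pi - k * fundAngle n := by
  rw [Nat.cast_sub h, ← mul_fundAngle n]
  push_cast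
  ring

end Trig

/-! ### Standard seeds with integral angles -/

/-- The parameters of a standard seed: its angles in multiples of the fundamental angle, its
orientation and its position along the belt line. -/
@[ext]
structure State (n : ℕ) where
  /-- the angle opposite to the side where the belt line enters -/
  a : ℕ
  /-- the angle opposite to the side where the belt line leaves -/
  c : ℕ
  /-- the orientation -/
  ε : ℝ
  /-- the position -/
  x : ℝ
  one_le_a : 1 ≤ a
  a_le : a ≤ n
  c_le : c ≤ n
  ε_sq : ε ^ 2 = 1

namespace State

variable {n : ℕ} (F : Frame) (K : ℝ)

/-- The standard seed with given parameters. -/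
def seed (s : State n) : LabelledSeed :=
  F.st K (s.a * fundAngle n) (s.c * fundAngle n) s.ε s.x

/-- Translation along the belt line, combined with the reflection in it if `δ = -1`. -/
def glide (δ r : ℝ) (hδ : δ ^ 2 = 1) (s : State n) : State n where
  a := s.a
  c := s.c
  ε := δ * s.ε
  x := s.x + r
  one_le_a := s.one_le_a
  a_le := s.a_le
  c_le := s.c_le
  ε_sq := by rw [mul_pow, hδ, s.ε_sq, one_mul]

/-- Mutation at the side where the belt line enters. -/
def mutIn (s : State n) : State n :=
  if h : s.a + s.c ≤ n then
    { a := s.a + s.c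
      c := s.c
      ε := s.ε
      x := s.x - Frame.shift K (s.a * fundAngle n) (s.c * fundAngle n)
      one_le_a := by have := s.one_le_a; omega
      a_le := h
      c_le := s.c_le
      ε_sq := s.ε_sq }
  else
    { a := 2 * n + 1 - (s.a + s.c)
      c := s.a
      ε := -s.ε
      x := s.x - Frame.shift K (s.a * fundAngle n) (s.c * fundAngle n)
      one_le_a := by have := s.a_le; have := s.c_le; omega
      a_le := by omega
      c_le := s.a_le
      ε_sq := by rw [neg_sq, s.ε_sq] }

/-- Mutation at the side where the belt line leaves. -/
def mutOut (s : State n) : State n :=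
  if h : s.a + s.c ≤ n then
    { a := s.a
      c := s.a + s.c
      ε := s.ε
      x := s.x
      one_le_a := s.one_le_a
      a_le := s.a_le
      c_le := h
      ε_sq := s.ε_sq }
  else
    { a := s.c
      c := 2 * n + 1 - (s.a + s.c)
      ε := -s.ε
      x := s.x + Frame.shift K (s.c * fundAngle n)
        ((2 * n + 1 - (s.a + s.c) : ℕ) * fundAngle n)
      one_le_a := by have := s.a_le; omega
      a_le := s.c_le
      c_le := by omega
      ε_sq := by rw [neg_sq, s.ε_sq] }

/-- Mutation at the third side. -/
def mutMid (s : State n) : State n :=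
  if h : s.a ≤ s.c then
    { a := s.a
      c := s.c - s.a
      ε := s.ε
      x := s.x
      one_le_a := s.one_le_a
      a_le := s.a_le
      c_le := by have := s.c_le; omega
      ε_sq := s.ε_sq }
  else
    { a := s.a - s.c
      c := s.c
      ε := s.ε
      x := s.x + Frame.shift K ((s.a - s.c : ℕ) * fundAngle n) (s.c * fundAngle n)
      one_le_a := by omega
      a_le := by have := s.a_le; omega
      c_le := s.c_le
      ε_sq := s.ε_sq }

/-- Mutation of the parameters of a standard seed. -/
def mutate (s : State n) : Fin 3 → State n := ![s.mutIn K, s.mutMid K, s.mutOut K]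

/-- The changes of `a` and `c`, the displacement of `x` and the factor ±1 on `ε` depend on `a` and
`c` only. -/
theorem mutate_glide (δ r : ℝ) (hδ : δ ^ 2 = 1) (s : State n) (k : Fin 3) :
    (s.glide δ r hδ).mutate K k = (s.mutate K k).glide δ r hδ := by
  fin_cases k
  · change (s.glide δ r hδ).mutIn K = (s.mutIn K).glide δ r hδ
    by_cases h : s.a + s.c ≤ n <;> ext <;> simp [mutIn, glide, h] <;> ring
  · change (s.glide δ r hδ).mutMid K = (s.mutMid K).glide δ r hδ
    by_cases h : s.a ≤ s.c <;> ext <;> simp [mutMid, glide, h]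
    ring
  · change (s.glide δ r hδ).mutOut K = (s.mutOut K).glide δ r hδ
    by_cases h : s.a + s.c ≤ n <;> ext <;> simp [mutOut, glide, h]
    ring

variable {F K} (s t : State n)

theorem sin_a_pos : 0 < Real.sin (s.a * fundAngle n) :=
  sin_mul_fundAngle_pos s.one_le_a (by have := s.a_le; omega)

theorem cos_a_pos : 0 < Real.cos (s.a * fundAngle n) := cos_mul_fundAngle_pos s.a_le

theorem cos_c_pos : 0 < Real.cos (s.c * fundAngle n) := cos_mul_fundAngle_pos s.c_le

theorem sin_c_pos_or : 0 < Real.sin (s.c * fundAngle n) ∨ s.c * fundAngle n = 0 := by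
  rcases Nat.eq_zero_or_pos s.c with h | h
  · right; simp [h]
  · exact .inl (sin_mul_fundAngle_pos h (by have := s.c_le; omega))

theorem angle_add : s.a * fundAngle n + s.c * fundAngle n = (s.a + s.c : ℕ) * fundAngle n := by
  push_cast; ring

theorem sin_add_pos : 0 < Real.sin (s.a * fundAngle n + s.c * fundAngle n) := by
  rw [angle_add]
  have := s.one_le_a; have := s.a_le; have := s.c_le
  exact sin_mul_fundAngle_pos (by omega) (by omega)

theorem cos_add_pos (h : s.a + s.c ≤ n) :
    0 < Real.cos (s.a * fundAngle n + s.c * fundAngle n) := by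
  rw [angle_add]
  exact cos_mul_fundAngle_pos h

theorem cos_add_neg (h : ¬ s.a + s.c ≤ n) :
    Real.cos (s.a * fundAngle n + s.c * fundAngle n) < 0 := by
  rw [angle_add]
  have := s.a_le; have := s.c_le
  exact cos_mul_fundAngle_neg (by omega) (by omega)

theorem shift_pos (hK : 0 < K) :
    0 < Frame.shift K (s.a * fundAngle n) (s.c * fundAngle n) := by
  have h1 := s.sin_a_pos
  have h2 := s.cos_c_pos
  have h3 := s.sin_add_pos
  unfold Frame.shift
  positivity

theorem seed_form_self (i : Fin 3) : ((s.seed F K).v i).form ((s.seed F K).v i) = 2 :=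
  Frame.st_form_self s.ε_sq i

theorem seed_neg_mem_pos (hK : 0 < K) (k : Fin 3) :
    -(s.seed F K).v k ∈ F.pos ↔ (s.seed F K).v k ∉ F.pos :=
  Frame.st_neg_mem_pos hK s.sin_a_pos s.cos_a_pos s.cos_c_pos s.sin_c_pos_or k

theorem seed_mutate_mutate (hK : 0 < K) (k : Fin 3) :
    ((s.seed F K).mutate F.pos k).mutate F.pos k = s.seed F K :=
  LabelledSeed.mutate_mutate (s.seed_form_self k) (s.seed_neg_mem_pos hK k)

/-- Since mutation is an involution, each explicitly computed mutation also yields the one in the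
opposite direction. This saves half of the geometric computations. -/
theorem seed_mutate_inverse (hK : 0 < K) {s t : State n} {k : Fin 3} {σ : Equiv.Perm (Fin 3)}
    (h : (s.seed F K).mutate F.pos k = (t.seed F K).perm σ) :
    (⟦(t.seed F K).mutate F.pos (σ k)⟧ : Seed) = ⟦s.seed F K⟧ := by
  have h1 := s.seed_mutate_mutate (F := F) hK k
  rw [h, LabelledSeed.perm_mutate] at h1
  rw [← h1, LabelledSeed.mk_perm]

theorem seed_mutIn_of_le (h : s.a + s.c ≤ n) :
    (s.seed F K).mutate F.pos 0 = ((s.mutIn K).seed F K).perm (Equiv.swap 0 1) := by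
  rw [seed, Frame.st_mutate_zero_of_pos s.ε_sq s.sin_a_pos s.cos_c_pos s.sin_add_pos
    (s.cos_add_pos h)]
  simp only [mutIn, h, dif_pos, seed, angle_add]

theorem seed_mutIn_of_not_le (h : ¬ s.a + s.c ≤ n) :
    (s.seed F K).mutate F.pos 0 = ((s.mutIn K).seed F K).perm rot := by
  rw [seed, Frame.st_mutate_zero_of_neg s.ε_sq s.sin_a_pos s.cos_c_pos s.sin_add_pos
    (s.cos_add_neg h)]
  simp only [mutIn, h, dif_neg, not_false_eq_true, seed]
  rw [sub_mul_fundAngle (by have := s.a_le; have := s.c_le; omega), angle_add]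

theorem seed_mutOut_of_le (hK : 0 < K) (h : s.a + s.c ≤ n) :
    (s.seed F K).mutate F.pos 2 = ((s.mutOut K).seed F K).perm (Equiv.swap 1 2) := by
  rw [seed, Frame.st_mutate_two_of_pos s.ε_sq s.sin_a_pos s.cos_a_pos
    (Frame.st_two_not_mem_pos hK s.sin_a_pos s.cos_a_pos s.sin_c_pos_or) (s.cos_add_pos h)]
  simp only [mutOut, h, dif_pos, seed, angle_add]

theorem mutIn_mutOut (h : ¬ s.a + s.c ≤ n) : (s.mutOut K).mutIn K = s := by
  have := s.a_le; have := s.c_le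
  have h1 : ¬ s.c + (2 * n + 1 - (s.a + s.c)) ≤ n := by omega
  ext <;> simp [mutIn, mutOut, h, h1]
  omega

theorem mutIn_mutMid (h : ¬ s.a ≤ s.c) : (s.mutMid K).mutIn K = s := by
  have := s.a_le; have := s.c_le
  have h1 : s.a - s.c + s.c ≤ n := by omega
  ext <;> simp [mutIn, mutMid, h, h1]
  omega

theorem mutOut_mutMid (h : s.a ≤ s.c) : (s.mutMid K).mutOut K = s := by
  have h2 : s.a + (s.c - s.a) = s.c := by omega
  ext <;> simp [mutOut, mutMid, h, h2, s.c_le]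

/-- Only mutation at side 0 and the cyclic mutation at side 2 come from geometry. Mutation at side 1
is the inverse of one of the cyclic ones, and the acyclic mutation at side 2 is the inverse of the
acyclic one at side 0. -/
theorem mk_seed_mutate (hK : 0 < K) (k : Fin 3) :
    (⟦(s.seed F K).mutate F.pos k⟧ : Seed) = ⟦(s.mutate K k).seed F K⟧ := by
  have := s.a_le; have := s.c_le; have := s.one_le_a
  fin_cases k
  · change (⟦(s.seed F K).mutate F.pos 0⟧ : Seed) = ⟦(s.mutIn K).seed F K⟧
    by_cases h : s.a + s.c ≤ n
    · rw [seed_mutIn_of_le s h, LabelledSeed.mk_perm]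
    · rw [seed_mutIn_of_not_le s h, LabelledSeed.mk_perm]
  · change (⟦(s.seed F K).mutate F.pos 1⟧ : Seed) = ⟦(s.mutMid K).seed F K⟧
    by_cases h : s.a ≤ s.c
    · have e := seed_mutOut_of_le (F := F) (s.mutMid K) hK (by simp only [mutMid, h, dif_pos]; omega)
      rw [mutOut_mutMid s h] at e
      exact seed_mutate_inverse hK e
    · have e := seed_mutIn_of_le (F := F) (K := K) (s.mutMid K) (by
        simp only [mutMid, h, dif_neg, not_false_eq_true]; omega)
      rw [mutIn_mutMid s h] at e
      exact seed_mutate_inverse hK e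
  · change (⟦(s.seed F K).mutate F.pos 2⟧ : Seed) = ⟦(s.mutOut K).seed F K⟧
    by_cases h : s.a + s.c ≤ n
    · rw [seed_mutOut_of_le s hK h, LabelledSeed.mk_perm]
    · have e := seed_mutIn_of_not_le (F := F) (K := K) (s.mutOut K) (by
        simp only [mutOut, h, dif_neg, not_false_eq_true]; omega)
      rw [mutIn_mutOut s h] at e
      exact seed_mutate_inverse hK e

/-! ### Uniqueness of the parameters -/

theorem perm_eq_one {s t : State n} {σ : Equiv.Perm (Fin 3)}
    (hform : ∀ i j, ((t.seed F K).v i).form ((t.seed F K).v j) =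
      ((s.seed F K).v (σ i)).form ((s.seed F K).v (σ j)))
    (hB : (t.seed F K).B = (s.seed F K).B.submatrix σ σ) :
    σ = 1 ∧ t.a = s.a ∧ t.c = s.c := by
  obtain ⟨h, h1, h2⟩ := Frame.st_perm_eq s.ε_sq t.ε_sq s.cos_a_pos s.cos_c_pos t.cos_a_pos
    t.cos_c_pos hform hB
  have := s.a_le; have := s.c_le; have := t.a_le; have := t.c_le
  exact ⟨h, cos_mul_fundAngle_inj (by omega) (by omega) h1,
    cos_mul_fundAngle_inj (by omega) (by omega) h2⟩

/-- Rigidity forces the labels and the angles to agree. The directions of the sides then give `ε`,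
and the lines of the sides 0 and 2 determine `x` and show that the translation has no component
across the axis. -/
theorem seed_translate_eq {s t : State n} {w : Plane}
    (h : (⟦t.seed F K⟧ : Seed) = Seed.translate w ⟦s.seed F K⟧) :
    ∃ r : ℝ, w = r • F.b 0 ∧ t = s.glide 1 r (one_pow 2) := by
  obtain ⟨σ, hσ⟩ := (LabelledSeed.mk_eq_iff _ _).1 h.symm
  have hv (i : Fin 3) : (t.seed F K).v i =
      ((s.seed F K).v (σ i)).move (AffineIsometryEquiv.constVAdd ℝ Plane w) := by rw [hσ]; rfl
  obtain ⟨rfl, ha, hc⟩ := perm_eq_one (F := F) (K := K) (s := s) (t := t) (σ := σ)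
    (fun i j => by rw [hv, hv, AffFun.move_form]) (by rw [hσ]; rfl)
  have hw := F.vec_eq w
  set r := inner ℝ (F.b 0) w
  set d := inner ℝ (F.b 1) w
  have h0 := hv 0
  have h2 := hv 2
  rw [hw] at h0 h2
  rw [Equiv.Perm.one_apply, seed, seed, Frame.st_v_zero, Frame.st_v_zero, Frame.fn_translate,
    Frame.fn_inj, ha] at h0
  rw [Equiv.Perm.one_apply, seed, seed, Frame.st_v_two, Frame.st_v_two, Frame.fn_translate,
    Frame.fn_inj, ha, hc] at h2
  have hε : t.ε = s.ε := mul_right_cancel₀ s.cos_a_pos.ne' h0.2.1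
  have e1 := h0.2.2
  have e2 := h2.2.2
  have hS := s.sin_add_pos
  rw [Real.sin_add] at hS
  have hx : t.x = s.x + r := by
    have : (t.x - s.x - r) * (Real.sin (s.a * fundAngle n) * Real.cos (s.c * fundAngle n) +
        Real.cos (s.a * fundAngle n) * Real.sin (s.c * fundAngle n)) = 0 := by
      -- This combination of the equations for the two lines eliminates the transversal component
      -- `d`.
      linear_combination Real.cos (s.c * fundAngle n) * e1 - Real.cos (s.a * fundAngle n) * e2
    have := (mul_eq_zero.1 this).resolve_right hS.ne'
    linarith
  have hd : d = 0 := by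
    rw [hx] at e1
    have h3 : d * (s.ε * Real.cos (s.a * fundAngle n)) = 0 := by linarith
    have h4 : s.ε ≠ 0 := by
      intro h; have := s.ε_sq; rw [h] at this; norm_num at this
    exact (mul_eq_zero.1 h3).resolve_right (mul_ne_zero h4 s.cos_a_pos.ne')
  refine ⟨r, by rw [hw, hd, zero_smul, add_zero], ?_⟩
  ext <;> simp [glide, ha, hc, hε, hx]

theorem seed_glide_one (r : ℝ) :
    (⟦(s.glide 1 r (one_pow 2)).seed F K⟧ : Seed) = Seed.translate (r • F.b 0) ⟦s.seed F K⟧ := by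
  have : (s.glide 1 r (one_pow 2)).seed F K =
      (s.seed F K).move (AffineIsometryEquiv.constVAdd ℝ Plane (r • F.b 0 + (0 : ℝ) • F.b 1)) := by
    refine LabelledSeed.ext (funext fun i => ?_) rfl
    fin_cases i
    all_goals
      simp [LabelledSeed.move, seed, Frame.st, glide, -zero_smul, Frame.fn_translate, Frame.fn_inj]
      ring
  rw [this, zero_smul, add_zero]
  rfl

theorem seed_glide_neg_one (L : AffineSubspace ℝ Plane) [Nonempty L] (hL : L = F.axis) :
    (⟦(s.glide (-1) 0 (by norm_num)).seed F K⟧ : Seed) =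
      Seed.move (EuclideanGeometry.reflection L) ⟦s.seed F K⟧ := by
  have : (s.glide (-1) 0 (by norm_num)).seed F K =
      (s.seed F K).move (EuclideanGeometry.reflection L) := by
    refine LabelledSeed.ext (funext fun i => ?_) rfl
    fin_cases i <;>
      simp [LabelledSeed.move, seed, Frame.st, glide, Frame.fn_reflect F L hL]
  rw [this]
  rfl

theorem seed_injective {s t : State n} (h : (⟦t.seed F K⟧ : Seed) = ⟦s.seed F K⟧) : t = s := by
  have h0 := s.seed_glide_one (F := F) (K := K) 0
  have e : s.glide 1 0 (one_pow 2) = s := by ext <;> simp [glide]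
  rw [e] at h0
  obtain ⟨r, hr, ht⟩ := seed_translate_eq (h.trans h0)
  rw [zero_smul, eq_comm, smul_eq_zero] at hr
  rcases hr with rfl | hr
  · rw [ht, e]
  · exact absurd hr (F.b.orthonormal.ne_zero 0)

/-! ### The mutation class of a standard seed -/

/-- Mutation equivalence of parameters. -/
def Orb (K : ℝ) : State n → State n → Prop :=
  Relation.ReflTransGen fun s t => ∃ k, t = s.mutate K k

/-- Deduced from the involution on seeds rather than from the formulas. The direction `l` may differ
from `k` because each standard seed carries its own labels. -/
theorem exists_mutate_mutate (F : Frame) (hK : 0 < K) (k : Fin 3) :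
    ∃ l, (s.mutate K k).mutate K l = s := by
  obtain ⟨σ, hσ⟩ := (LabelledSeed.mk_eq_iff _ _).1 (s.mk_seed_mutate (F := F) hK k)
  have h1 := s.seed_mutate_mutate (F := F) hK k
  refine ⟨σ.symm k, seed_injective (F := F) (K := K) ?_⟩
  rw [← mk_seed_mutate _ hK, hσ, LabelledSeed.perm_mutate, LabelledSeed.mk_perm,
    Equiv.apply_symm_apply, h1]

theorem Orb.symm (F : Frame) (hK : 0 < K) {s t : State n} (h : Orb K s t) : Orb K t s := by
  induction h with
  | refl => exact .refl
  | @tail y z _ hyz ih =>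
    obtain ⟨k, rfl⟩ := hyz
    obtain ⟨l, hl⟩ := exists_mutate_mutate y F hK k
    exact .head ⟨l, hl.symm⟩ ih

theorem Orb.glide {s t : State n} (h : Orb K s t) (δ r : ℝ) (hδ : δ ^ 2 = 1) :
    Orb K (s.glide δ r hδ) (t.glide δ r hδ) := by
  induction h with
  | refl => exact .refl
  | tail _ hyz ih =>
    obtain ⟨k, rfl⟩ := hyz
    exact ih.tail ⟨k, (mutate_glide K δ r hδ _ k).symm⟩

/-- If a mutation class is mapped to itself somewhere by a glide reflection or a translation, it is
so everywhere. -/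
theorem Orb.glide_mem (F : Frame) (hK : 0 < K) {o s t : State n} {δ r : ℝ} {hδ : δ ^ 2 = 1}
    (h : Orb K o s) (h' : Orb K o (s.glide δ r hδ)) (ht : Orb K o t) :
    Orb K o (t.glide δ r hδ) :=
  h'.trans (Orb.glide ((h.symm F hK).trans ht) δ r hδ)

/-- The mutation class of a standard seed consists of standard seeds. -/
theorem mem_class_iff (hK : 0 < K) (o : State n) (q : Seed) :
    (∃ x : LabelledSeed, (⟦x⟧ : Seed) = q ∧
      Relation.ReflTransGen (fun y z => ∃ k, z = y.mutate F.pos k) (o.seed F K) x) ↔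
      ∃ t, Orb K o t ∧ q = ⟦t.seed F K⟧ := by
  constructor
  · rintro ⟨x, rfl, h⟩
    induction h with
    | refl => exact ⟨o, .refl, rfl⟩
    | @tail y z _ hyz ih =>
      obtain ⟨k, rfl⟩ := hyz
      obtain ⟨t, ht, e⟩ := ih
      obtain ⟨σ, rfl⟩ := (LabelledSeed.mk_eq_iff _ _).1 e.symm
      refine ⟨t.mutate K (σ k), ht.tail ⟨_, rfl⟩, ?_⟩
      rw [LabelledSeed.perm_mutate, LabelledSeed.mk_perm, mk_seed_mutate _ hK]
  · rintro ⟨t, h, rfl⟩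
    induction h with
    | refl => exact ⟨_, rfl, .refl⟩
    | @tail y z _ hyz ih =>
      obtain ⟨k, rfl⟩ := hyz
      obtain ⟨x, e, hx⟩ := ih
      obtain ⟨σ, rfl⟩ := (LabelledSeed.mk_eq_iff _ _).1 e.symm
      refine ⟨_, ?_, hx.tail ⟨σ.symm k, rfl⟩⟩
      rw [LabelledSeed.perm_mutate, LabelledSeed.mk_perm, Equiv.apply_symm_apply,
        mk_seed_mutate _ hK]

/-- The single mutations of a standard seed. -/
theorem step_iff (hK : 0 < K) (q : Seed) :
    (∃ (x : LabelledSeed) (k : Fin 3), (⟦x⟧ : Seed) = ⟦s.seed F K⟧ ∧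
      (⟦x.mutate F.pos k⟧ : Seed) = q) ↔ ∃ k, q = ⟦(s.mutate K k).seed F K⟧ := by
  constructor
  · rintro ⟨x, k, e, rfl⟩
    obtain ⟨σ, rfl⟩ := (LabelledSeed.mk_eq_iff _ _).1 e.symm
    exact ⟨σ k, by rw [LabelledSeed.perm_mutate, LabelledSeed.mk_perm, mk_seed_mutate _ hK]⟩
  · rintro ⟨k, rfl⟩
    exact ⟨_, k, rfl, mk_seed_mutate _ hK k⟩

/-! ### Connectedness -/

/-- Some parameters with given angles occur in the mutation class of `o`. -/
def Occurs (K : ℝ) (o : State n) (a c : ℕ) : Prop := ∃ t, Orb K o t ∧ t.a = a ∧ t.c = c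

/-- Mutation at side 1 performs one subtraction of the Euclidean algorithm, and mutation at side 0
or 2 undoes it. Each intermediate sum is at most `n`, so these inverse steps are in the cyclic
range. -/
theorem occurs_iff_gcd (o : State n) : ∀ (N a c : ℕ), a + c = N → 1 ≤ a → a ≤ n → c ≤ n →
    (Occurs K o a c ↔ Occurs K o (Nat.gcd a c) 0) := by
  intro N
  induction N using Nat.strong_induction_on with
  | _ N ih =>
    intro a c hN ha han hcn
    rcases Nat.eq_zero_or_pos c with rfl | hc
    · simp
    · by_cases hac : a ≤ c
      · have e : Nat.gcd a c = Nat.gcd a (c - a) := (Nat.gcd_sub_self_right hac).symm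
        rw [e, ← ih (a + (c - a)) (by omega) a (c - a) rfl ha han (by omega)]
        constructor
        · rintro ⟨t, ht, rfl, rfl⟩
          refine ⟨t.mutate K 1, ht.tail ⟨1, rfl⟩, ?_, ?_⟩ <;> simp [mutate, mutMid, hac]
        · rintro ⟨t, ht, rfl, h⟩
          have h1 : t.a + t.c ≤ n := by omega
          refine ⟨t.mutate K 2, ht.tail ⟨2, rfl⟩, ?_, ?_⟩ <;> simp [mutate, mutOut, h1]
          omega
      · have e : Nat.gcd a c = Nat.gcd (a - c) c :=
          (Nat.gcd_sub_self_left (by omega)).symm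
        rw [e, ← ih (a - c + c) (by omega) (a - c) c rfl (by omega) (by omega) hcn]
        constructor
        · rintro ⟨t, ht, rfl, rfl⟩
          refine ⟨t.mutate K 1, ht.tail ⟨1, rfl⟩, ?_, ?_⟩ <;> simp [mutate, mutMid, hac]
        · rintro ⟨t, ht, h, rfl⟩
          have h1 : t.a + t.c ≤ n := by omega
          refine ⟨t.mutate K 0, ht.tail ⟨0, rfl⟩, ?_, ?_⟩ <;> simp [mutate, mutIn, h1]
          omega

/-- Euclidean steps alone preserve gcd(a, c). A single passage through an acyclic seed brings in the
third angle 2n + 1 - a - c and reduces the gcd to that with 2n + 1, which is 1. -/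
theorem occurs_of_gcd_eq_one (o : State n) (hoa : o.a = 1) {a c : ℕ} (ha : 1 ≤ a) (han : a ≤ n)
    (hcn : c ≤ n) (hg : Nat.gcd (Nat.gcd a c) (2 * n + 1) = 1) : Occurs K o a c := by
  have h0 : Occurs K o 1 0 := by
    have : Occurs K o o.a o.c := ⟨o, .refl, rfl, rfl⟩
    rw [occurs_iff_gcd o _ _ _ rfl o.one_le_a o.a_le o.c_le, hoa, Nat.gcd_one_left] at this
    exact this
  rw [occurs_iff_gcd o _ _ _ rfl ha han hcn]
  set g := Nat.gcd a c with hgdef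
  have hg1 : 1 ≤ g := Nat.gcd_pos_of_pos_left _ ha
  have hgn : g ≤ n := (Nat.gcd_le_left _ ha).trans han
  -- The multiple `n / g * g` is the largest multiple of `g` up to `n`, so the pair (g, n / g * g)
  -- belongs to an acyclic seed and still has gcd `g`.
  have hk : n / g * g ≤ n := Nat.div_mul_le_self n g
  have hk' : n < n / g * g + g := by
    have := Nat.lt_div_mul_add (a := n) hg1
    omega
  have e1 := occurs_iff_gcd (K := K) o _ g (n / g * g) rfl hg1 hgn hk
  rw [Nat.gcd_mul_left_right] at e1
  rw [← e1]
  -- The source mutation of that acyclic seed has this pair of angles, which are coprime because the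
  -- first is congruent to 2n + 1 modulo `g`.
  have h2 : Occurs K o (2 * n + 1 - (n / g * g + g)) g := by
    rw [occurs_iff_gcd o _ _ _ rfl (by omega) (by omega) hgn]
    have : Nat.gcd (2 * n + 1 - (n / g * g + g)) g = 1 := by
      refine Eq.trans ?_ hg
      rw [Nat.gcd_comm g]
      have e : 2 * n + 1 = (2 * n + 1 - (n / g * g + g)) + (n / g + 1) * g := by
        rw [add_mul, one_mul]; omega
      conv_rhs => rw [e]
      rw [Nat.gcd_add_mul_right_left]
    rw [this]
    exact h0
  obtain ⟨t, ht, h3, h4⟩ := h2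
  have h5 : ¬ t.a + t.c ≤ n := by omega
  refine ⟨t.mutate K 2, ht.tail ⟨2, rfl⟩, ?_, ?_⟩ <;> simp [mutate, mutOut, h5]
  · exact h4
  · omega

theorem mutIn_a (h : ¬ s.a + s.c ≤ n) : (s.mutIn K).a = 2 * n + 1 - (s.a + s.c) := by
  simp only [mutIn, h, dif_neg, not_false_eq_true]

theorem mutIn_c (h : ¬ s.a + s.c ≤ n) : (s.mutIn K).c = s.a := by
  simp only [mutIn, h, dif_neg, not_false_eq_true]

theorem mutIn_ε (h : ¬ s.a + s.c ≤ n) : (s.mutIn K).ε = -s.ε := by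
  simp only [mutIn, h, dif_neg, not_false_eq_true]

theorem mutIn_x_lt (hK : 0 < K) : (s.mutIn K).x < s.x := by
  have := s.shift_pos hK
  by_cases h : s.a + s.c ≤ n <;> simp [mutIn, h, this]

/-- Each acyclic source mutation rotates the three angles and reverses the orientation. Three of
them restore the pair, along (1, n), (n, 1), (n, n), (1, n), and leave the orientation reversed. -/
theorem exists_glide (o : State n) (hn : 1 ≤ n) (ha : o.a = 1) (hc : o.c = n) :
    ∃ y, Orb K o (o.glide (-1) y (by norm_num)) := by
  have h1 : ¬ o.a + o.c ≤ n := by omega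
  have h2 : ¬ (o.mutIn K).a + (o.mutIn K).c ≤ n := by rw [mutIn_a _ h1, mutIn_c _ h1]; omega
  have h3 : ¬ ((o.mutIn K).mutIn K).a + ((o.mutIn K).mutIn K).c ≤ n := by
    rw [mutIn_a _ h2, mutIn_c _ h2, mutIn_a _ h1, mutIn_c _ h1]; omega
  have hO : Orb K o (((o.mutIn K).mutIn K).mutIn K) :=
    ((Relation.ReflTransGen.refl.tail ⟨0, rfl⟩).tail ⟨0, rfl⟩).tail ⟨0, rfl⟩
  refine ⟨(((o.mutIn K).mutIn K).mutIn K).x - o.x, ?_⟩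
  convert hO using 1
  refine State.ext ?_ ?_ ?_ ?_
  · rw [mutIn_a _ h3, mutIn_a _ h2, mutIn_c _ h2, mutIn_a _ h1, mutIn_c _ h1]
    simp only [glide]; omega
  · rw [mutIn_c _ h3, mutIn_a _ h2, mutIn_a _ h1, mutIn_c _ h1]
    simp only [glide]; omega
  · rw [mutIn_ε _ h3, mutIn_ε _ h2, mutIn_ε _ h1]
    simp [glide]
  · simp [glide]

end State

/-! ### Congruence of triples of affine linear functions -/

theorem AffFun.form_comm (f g : AffFun) : f.form g = g.form f := real_inner_comm _ _

theorem AffFun.eval_add (f g : AffFun) (p : Plane) : (f + g).eval p = f.eval p + g.eval p := by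
  simp only [AffFun.eval, Prod.fst_add, Prod.snd_add, inner_add_left]; ring

theorem AffFun.eval_smul (t : ℝ) (f : AffFun) (p : Plane) : (t • f).eval p = t * f.eval p := by
  simp only [AffFun.eval, Prod.smul_fst, Prod.smul_snd, real_inner_smul_left, smul_eq_mul]; ring

theorem linearIndependent_of_gram {x y : Plane}
    (h : inner ℝ x x * inner ℝ y y - inner ℝ x y * inner ℝ x y ≠ (0 : ℝ)) :
    LinearIndependent ℝ ![x, y] := by
  rw [LinearIndependent.pair_iff]
  intro s t hst
  have h1 : inner ℝ x (s • x + t • y) = (0 : ℝ) := by rw [hst, inner_zero_right]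
  have h2 : inner ℝ y (s • x + t • y) = (0 : ℝ) := by rw [hst, inner_zero_right]
  rw [inner_add_right, real_inner_smul_right, real_inner_smul_right] at h1 h2
  rw [real_inner_comm x y] at h2
  constructor
  · refine (mul_eq_zero.1 (?_ : s * _ = 0)).resolve_right h
    linear_combination inner ℝ y y * h1 - inner ℝ x y * h2
  · refine (mul_eq_zero.1 (?_ : t * _ = 0)).resolve_right h
    linear_combination inner ℝ x x * h2 - inner ℝ x y * h1

theorem exists_inner_eq {x y : Plane}
    (h : inner ℝ x x * inner ℝ y y - inner ℝ x y * inner ℝ x y ≠ (0 : ℝ)) (d e : ℝ) :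
    ∃ u : Plane, inner ℝ x u = d ∧ inner ℝ y u = e := by
  set D := inner ℝ x x * inner ℝ y y - inner ℝ x y * inner ℝ x y with hD
  refine ⟨((d * inner ℝ y y - e * inner ℝ x y) / D) • x +
    ((e * inner ℝ x x - d * inner ℝ x y) / D) • y, ?_, ?_⟩
  · rw [inner_add_right, real_inner_smul_right, real_inner_smul_right]
    field_simp
    rw [hD]; ring
  · rw [inner_add_right, real_inner_smul_right, real_inner_smul_right, real_inner_comm x y]
    field_simp
    rw [hD]; ring

theorem exists_linearIsometryEquiv {x y x' y' : Plane}
    (h : inner ℝ x x * inner ℝ y y - inner ℝ x y * inner ℝ x y ≠ (0 : ℝ))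
    (hxx : inner ℝ x' x' = (inner ℝ x x : ℝ)) (hyy : inner ℝ y' y' = (inner ℝ y y : ℝ))
    (hxy : inner ℝ x' y' = (inner ℝ x y : ℝ)) :
    ∃ T : Plane ≃ₗᵢ[ℝ] Plane, T x' = x ∧ T y' = y := by
  have hc : Fintype.card (Fin 2) = Module.finrank ℝ Plane := by simp
  let b := basisOfLinearIndependentOfCardEqFinrank (linearIndependent_of_gram h) hc
  let b' := basisOfLinearIndependentOfCardEqFinrank
    (linearIndependent_of_gram (x := x') (y := y') (by rwa [hxx, hyy, hxy])) hc
  have hb : ⇑b = ![x, y] := coe_basisOfLinearIndependentOfCardEqFinrank _ _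
  have hb' : ⇑b' = ![x', y'] := coe_basisOfLinearIndependentOfCardEqFinrank _ _
  let T := b'.equiv b (Equiv.refl _)
  have hT0 : T x' = x := by
    have := b'.equiv_apply 0 b (Equiv.refl _)
    simpa [hb, hb'] using this
  have hT1 : T y' = y := by
    have := b'.equiv_apply 1 b (Equiv.refl _)
    simpa [hb, hb'] using this
  refine ⟨T.isometryOfInner fun p q => ?_, hT0, hT1⟩
  have hp := b'.sum_repr p
  have hq := b'.sum_repr q
  simp only [Fin.sum_univ_two, hb', Matrix.cons_val_zero, Matrix.cons_val_one] at hp hq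
  rw [← hp, ← hq]
  simp only [map_add, map_smul, hT0, hT1, inner_add_left, inner_add_right, real_inner_smul_left,
    real_inner_smul_right, real_inner_comm x y, real_inner_comm x' y', hxx, hyy, hxy]

theorem move_eq (T : Plane ≃ₗᵢ[ℝ] Plane) (u : Plane) (f : AffFun) :
    f.move (T.toAffineIsometryEquiv.trans (AffineIsometryEquiv.constVAdd ℝ Plane u)) =
      (T f.1, f.2 - inner ℝ (T f.1) u) := by
  refine AffFun.ext_eval fun p => ?_
  obtain ⟨p, rfl⟩ := (T.toAffineIsometryEquiv.trans
    (AffineIsometryEquiv.constVAdd ℝ Plane u)).surjective p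
  rw [AffFun.eval_move, AffineIsometryEquiv.symm_apply_apply]
  simp [AffFun.eval, inner_add_right]
  ring

theorem sum_fin_three_shift {M : Type*} [AddCommMonoid M] (f : Fin 3 → M) (k : Fin 3) :
    ∑ i, f i = f k + f (k + 1) + f (k + 2) := by
  rw [Fin.sum_univ_three]
  fin_cases k
  · rfl
  · change f 0 + f 1 + f 2 = f 1 + f 2 + f 0
    abel
  · change f 0 + f 1 + f 2 = f 2 + f 0 + f 1
    abel

theorem gram_ne_zero {f g : AffFun} {θ : ℝ} (hf : f.form f = 2) (hg : g.form g = 2)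
    (hfg : f.form g = -(2 * Real.cos θ)) (hθ : Real.sin θ ≠ 0) :
    inner ℝ f.1 f.1 * inner ℝ g.1 g.1 - inner ℝ f.1 g.1 * inner ℝ f.1 g.1 ≠ (0 : ℝ) := by
  simp only [AffFun.form] at hf hg hfg
  rw [hf, hg, hfg]
  have := Real.sin_sq_add_cos_sq θ
  have h2 : 0 < Real.sin θ ^ 2 := by positivity
  intro h
  nlinarith

/-- Two triangles with the same angles are congruent if their sizes, measured by the value of the
constant function `∑ i, sin (θ i) • v i`, coincide. -/
theorem areCongruent_of_sum_eq {v v' : Fin 3 → AffFun} {θ : Fin 3 → ℝ} {κ : ℝ}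
    (hs : ∀ i, (v i).form (v i) = 2) (hs' : ∀ i, (v' i).form (v' i) = 2)
    (hf : ∀ i, (v (i + 1)).form (v (i + 2)) = -(2 * Real.cos (θ i)))
    (hf' : ∀ i, (v' (i + 1)).form (v' (i + 2)) = -(2 * Real.cos (θ i)))
    (hr : ∑ i, Real.sin (θ i) • v i = (0, κ)) (hr' : ∑ i, Real.sin (θ i) • v' i = (0, κ))
    {k : Fin 3} (hk : Real.sin (θ k) ≠ 0) : AreCongruent v v' := by
  have hg := gram_ne_zero (hs (k + 1)) (hs (k + 2)) (hf k) hk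
  obtain ⟨T, hT1, hT2⟩ := exists_linearIsometryEquiv hg
    (x' := (v' (k + 1)).1) (y' := (v' (k + 2)).1)
    ((hs' _).trans (hs _).symm) ((hs' _).trans (hs _).symm) ((hf' _).trans (hf _).symm)
  obtain ⟨u, hu1, hu2⟩ := exists_inner_eq hg ((v' (k + 1)).2 - (v (k + 1)).2)
    ((v' (k + 2)).2 - (v (k + 2)).2)
  refine ⟨T.toAffineIsometryEquiv.trans (AffineIsometryEquiv.constVAdd ℝ Plane u), ?_⟩
  have h1 : v (k + 1) = (v' (k + 1)).move (T.toAffineIsometryEquiv.trans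
      (AffineIsometryEquiv.constVAdd ℝ Plane u)) := by
    rw [move_eq, hT1, hu1]; exact Prod.ext rfl (by ring)
  have h2 : v (k + 2) = (v' (k + 2)).move (T.toAffineIsometryEquiv.trans
      (AffineIsometryEquiv.constVAdd ℝ Plane u)) := by
    rw [move_eq, hT2, hu2]; exact Prod.ext rfl (by ring)
  rw [sum_fin_three_shift _ k] at hr hr'
  have hr1 := congrArg Prod.fst hr
  have hr2 := congrArg Prod.snd hr
  have hr1' := congrArg Prod.fst hr'
  have hr2' := congrArg Prod.snd hr'
  simp only [Prod.fst_add, Prod.snd_add, Prod.smul_fst, Prod.smul_snd, smul_eq_mul] at hr1 hr2 hr1' hr2'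
  have e1 : T (v' k).1 = (v k).1 := by
    have := congrArg T hr1'
    simp only [map_add, map_smul, hT1, hT2, map_zero] at this
    rw [← hr1] at this
    -- The isometry was chosen to match two of the sides; since the coefficient of the third in the
    -- linear relation is nonzero, the relation forces that one to match as well.
    exact smul_right_injective _ hk (add_right_cancel (add_right_cancel this))
  have h0 : v k = (v' k).move (T.toAffineIsometryEquiv.trans
      (AffineIsometryEquiv.constVAdd ℝ Plane u)) := by
    rw [move_eq, e1]
    refine Prod.ext rfl ?_
    have := congrArg (fun z => inner ℝ z u) hr1
    simp only [inner_add_left, real_inner_smul_left, inner_zero_left, hu1, hu2] at this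
    have h3 : Real.sin (θ k) * ((v k).2 - ((v' k).2 - inner ℝ (v k).1 u)) = 0 := by
      linear_combination this + hr2 - hr2'
    have := (mul_eq_zero.1 h3).resolve_left hk
    simp only
    linarith
  have all : ∀ i k : Fin 3, i = k ∨ i = k + 1 ∨ i = k + 2 := by decide
  intro i
  rcases all i k with rfl | rfl | rfl <;> assumption

theorem AreCongruent.form_eq {v v' : Fin 3 → AffFun} (h : AreCongruent v v') (i j : Fin 3) :
    (v i).form (v j) = (v' i).form (v' j) := by
  obtain ⟨φ, hφ⟩ := h
  rw [hφ, hφ, AffFun.move_form]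

theorem pi_sub_angle_eq {f g : AffFun} {θ : ℝ} (hf : f.form f = 2) (hg : g.form g = 2)
    (hfg : f.form g = -(2 * Real.cos θ)) (h0 : 0 ≤ θ) (hπ : θ ≤ Real.pi) :
    Real.pi - InnerProductGeometry.angle f.1 g.1 = θ := by
  simp only [AffFun.form] at hf hg hfg
  have nf : ‖f.1‖ = √2 := by rw [norm_eq_sqrt_real_inner, hf]
  have ng : ‖g.1‖ = √2 := by rw [norm_eq_sqrt_real_inner, hg]
  rw [InnerProductGeometry.angle, nf, ng, hfg, Real.mul_self_sqrt (by norm_num),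
    show -(2 * Real.cos θ) / 2 = -Real.cos θ by ring, Real.arccos_neg, Real.arccos_cos h0 hπ]
  ring

theorem domain_comp (v : Fin 3 → AffFun) (σ : Equiv.Perm (Fin 3)) : domain (v ∘ σ) = domain v :=
  σ.surjective.iInter_comp fun i => (v i).halfPlane

/-! ### Angles of standard seeds -/

/-- The sines are proportional to the side lengths, and the functions are √2 times the signed
distances from the sides. For a proper triangle, K is thus the area divided by the circumradius; the
relation remains valid for infinite regions. -/
theorem Frame.st_sum (F : Frame) {K A C ε x : ℝ} (hA : Real.sin A ≠ 0) :
    Real.sin A • (F.st K A C ε x).v 0 + Real.sin (Real.pi - (A + C)) • (F.st K A C ε x).v 1 +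
      Real.sin C • (F.st K A C ε x).v 2 = ((0, -(√2 * K)) : AffFun) := by
  have e : ((0, -(√2 * K)) : AffFun) = F.fn 0 0 (-K) := by simp [Frame.fn]
  have h1 := Real.sin_sq_add_cos_sq A
  have h2 := Real.sin_sq_add_cos_sq C
  rw [st_v_zero, st_v_one, st_v_two, fn_smul, fn_smul, fn_smul, fn_add, fn_add, e, fn_inj,
    Real.sin_pi_sub, Real.sin_sub, Real.cos_sub, Real.sin_add, Real.cos_add]
  refine ⟨?_, ?_, ?_⟩
  · linear_combination Real.sin A ^ 2 * h2 - Real.sin C ^ 2 * h1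
  · linear_combination -ε * Real.sin A * Real.cos A * h2 - ε * Real.sin C * Real.cos C * h1
  · field_simp
    linear_combination (x * Real.sin A * Real.sin C ^ 2) * h1 -
      (x * Real.sin A ^ 3 + K * Real.sin A) * h2

namespace State

variable {n : ℕ} {F : Frame} {K : ℝ} (s t : State n)

/-- The angles of a standard seed, in multiples of the fundamental angle. -/
def ang : Fin 3 → ℕ := ![s.a, 2 * n + 1 - (s.a + s.c), s.c]

theorem add_le : s.a + s.c ≤ 2 * n + 1 := by
  have := s.a_le; have := s.c_le; omega

theorem ang_le (i : Fin 3) : s.ang i ≤ 2 * n + 1 := by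
  have := s.add_le
  fin_cases i <;> simp [ang] <;> omega

theorem seed_form_of_ne {i j k : Fin 3} (hij : i ≠ j) (hjk : j ≠ k) (hik : i ≠ k) :
    ((s.seed F K).v i).form ((s.seed F K).v j) = -(2 * Real.cos (s.ang k * fundAngle n)) := by
  have h2 : -(2 * Real.cos ((2 * n + 1 - (s.a + s.c) : ℕ) * fundAngle n)) =
      2 * Real.cos (s.a * fundAngle n + s.c * fundAngle n) := by
    rw [sub_mul_fundAngle s.add_le, Real.cos_pi_sub, s.angle_add]; ring
  have f10 := Frame.st_form_one_zero (F := F) (K := K) (A := s.a * fundAngle n)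
    (C := s.c * fundAngle n) (x := s.x) s.ε_sq
  have f20 := Frame.st_form_two_zero (F := F) (K := K) (A := s.a * fundAngle n)
    (C := s.c * fundAngle n) (x := s.x) s.ε_sq
  have f12 := Frame.st_form_one_two (F := F) (K := K) (A := s.a * fundAngle n)
    (C := s.c * fundAngle n) (x := s.x) s.ε_sq
  have f01 := f10; have f02 := f20; have f21 := f12
  rw [AffFun.form_comm] at f01 f02 f21
  have key : ∀ i j k : Fin 3, i ≠ j → j ≠ k → i ≠ k → (i, j, k) = (0, 1, 2) ∨
      (i, j, k) = (1, 0, 2) ∨ (i, j, k) = (0, 2, 1) ∨ (i, j, k) = (2, 0, 1) ∨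
      (i, j, k) = (1, 2, 0) ∨ (i, j, k) = (2, 1, 0) := by decide
  rcases key i j k hij hjk hik with h | h | h | h | h | h <;> simp only [Prod.mk.injEq] at h <;>
    obtain ⟨rfl, rfl, rfl⟩ := h
  · exact f01
  · exact f10
  · exact f02.trans h2.symm
  · exact f20.trans h2.symm
  · exact f12
  · exact f21

theorem seed_sum : ∑ i, Real.sin (s.ang i * fundAngle n) • (s.seed F K).v i =
    ((0, -(√2 * K)) : AffFun) := by
  have h := F.st_sum (K := K) (A := s.a * fundAngle n) (C := s.c * fundAngle n) (ε := s.ε)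
    (x := s.x) s.sin_a_pos.ne'
  rw [Fin.sum_univ_three, ← h, s.angle_add, ← sub_mul_fundAngle s.add_le]
  rfl

theorem domain_nonempty (hK : 0 < K) : (domain (s.seed F K).v).Nonempty := by
  have hS : (0 : ℝ) < √2 * K := by positivity
  have hsin := s.sin_a_pos
  -- Prescribe a quarter of the constant -√2 K for the functions 1 and 2. As sines are at most 1,
  -- these two use up at most half of the constant, so the relation makes function 0 negative too.
  obtain ⟨p, h1, h2⟩ := exists_inner_eq
    (gram_ne_zero (s.seed_form_self (F := F) (K := K) 1) (s.seed_form_self 2)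
      (s.seed_form_of_ne (k := 0) (by decide) (by decide) (by decide)) hsin.ne')
    (-(√2 * K) / 4 - ((s.seed F K).v 1).2) (-(√2 * K) / 4 - ((s.seed F K).v 2).2)
  have e1 : ((s.seed F K).v 1).eval p = -(√2 * K) / 4 := by rw [AffFun.eval, h1]; ring
  have e2 : ((s.seed F K).v 2).eval p = -(√2 * K) / 4 := by rw [AffFun.eval, h2]; ring
  have h := congrArg (fun f => AffFun.eval f p) (s.seed_sum (F := F) (K := K))
  simp only [Fin.sum_univ_three, AffFun.eval_add, AffFun.eval_smul, e1, e2] at h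
  have e : AffFun.eval ((0, -(√2 * K)) : AffFun) p = -(√2 * K) := by simp [AffFun.eval]
  rw [e] at h
  have e0 : ((s.seed F K).v 0).eval p < 0 := by
    have b1 := Real.sin_le_one (s.ang 1 * fundAngle n)
    have b2 := Real.sin_le_one (s.ang 2 * fundAngle n)
    have e3 : (s.ang 0 : ℝ) = s.a := rfl
    rw [e3] at h
    by_contra h'
    push Not at h'
    nlinarith [mul_nonneg hsin.le h']
  refine ⟨p, Set.mem_iInter.2 fun i => ?_⟩
  fin_cases i
  · exact e0
  · exact e1.trans_lt (by linarith)
  · exact e2.trans_lt (by linarith)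

theorem ne_add_one_add_two : ∀ i : Fin 3, i + 1 ≠ i + 2 ∧ i + 2 ≠ i ∧ i + 1 ≠ i := by decide

theorem perm_form (σ : Equiv.Perm (Fin 3)) (i : Fin 3) :
    (((s.seed F K).perm σ).v (i + 1)).form (((s.seed F K).perm σ).v (i + 2)) =
      -(2 * Real.cos (s.ang (σ i) * fundAngle n)) := by
  obtain ⟨h1, h2, h3⟩ := ne_add_one_add_two i
  exact s.seed_form_of_ne (σ.injective.ne h1) (σ.injective.ne h2) (σ.injective.ne h3)

theorem perm_pi_sub_angle (σ : Equiv.Perm (Fin 3)) (i : Fin 3) :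
    Real.pi - InnerProductGeometry.angle (((s.seed F K).perm σ).v (i + 1)).1
      (((s.seed F K).perm σ).v (i + 2)).1 = s.ang (σ i) * fundAngle n :=
  pi_sub_angle_eq (s.seed_form_self _) (s.seed_form_self _) (s.perm_form σ i)
    (mul_fundAngle_nonneg _ _) (mul_fundAngle_le_pi (s.ang_le _))

theorem hasAngles_perm (hK : 0 < K) {σ : Equiv.Perm (Fin 3)} {m : Fin 3 → ℕ}
    (hm : ∀ i, s.ang (σ i) = m i) :
    HasAngles ((s.seed F K).perm σ).v fun i => m i * fundAngle n := by
  refine ⟨?_, fun i => ?_⟩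
  · change (domain ((s.seed F K).v ∘ σ)).Nonempty
    rw [domain_comp]
    exact s.domain_nonempty hK
  · rw [perm_pi_sub_angle, hm]

theorem ang_eq_of_hasAngles {σ : Equiv.Perm (Fin 3)} {m : Fin 3 → ℕ}
    (h : HasAngles ((s.seed F K).perm σ).v fun i => m i * fundAngle n) (i : Fin 3) :
    s.ang (σ i) = m i := by
  have := (perm_pi_sub_angle s σ i).symm.trans (h.2 i)
  have := mul_right_cancel₀ (fundAngle_pos n).ne' this
  exact_mod_cast this

theorem perm_sum (σ : Equiv.Perm (Fin 3)) :
    ∑ i, Real.sin (s.ang (σ i) * fundAngle n) • ((s.seed F K).perm σ).v i =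
      ((0, -(√2 * K)) : AffFun) := by
  rw [← s.seed_sum (F := F)]
  exact Equiv.sum_comp σ fun i => Real.sin (s.ang i * fundAngle n) • (s.seed F K).v i

theorem areCongruent_perm {s t : State n} {σ τ : Equiv.Perm (Fin 3)} {m : Fin 3 → ℕ}
    (hs : ∀ i, s.ang (σ i) = m i) (ht : ∀ i, t.ang (τ i) = m i) :
    AreCongruent ((s.seed F K).perm σ).v ((t.seed F K).perm τ).v := by
  -- The side labelled 0 in `s` serves as the third side, because its opposite angle is at least α
  -- and has nonzero sine even for an infinite region.
  refine areCongruent_of_sum_eq (θ := fun i => m i * fundAngle n) (κ := -(√2 * K))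
    (k := σ.symm 0) (fun i => s.seed_form_self _) (fun i => t.seed_form_self _)
    (fun i => ?_) (fun i => ?_) ?_ ?_ ?_
  · rw [perm_form, hs]
  · rw [perm_form, ht]
  · simp_rw [← hs]
    exact s.perm_sum σ
  · simp_rw [← ht]
    exact t.perm_sum τ
  · simp only [← hs, Equiv.apply_symm_apply]
    exact s.sin_a_pos.ne'

end State

/-! ### Acyclic and cyclic quivers -/

theorem isAcyclic_submatrix {B : Matrix (Fin 3) (Fin 3) ℝ} (σ : Equiv.Perm (Fin 3))
    (h : IsAcyclic B) : IsAcyclic (B.submatrix σ σ) := by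
  intro i hi
  have : ∀ j, Relation.TransGen (fun a b => 0 < B.submatrix σ σ a b) i j →
      Relation.TransGen (fun a b => 0 < B a b) (σ i) (σ j) := fun j hj => by
    induction hj with
    | single h => exact .single h
    | tail _ h ih => exact ih.tail h
  exact h (σ i) (this i hi)

theorem isAcyclic_of_rank {B : Matrix (Fin 3) (Fin 3) ℝ} (f : Fin 3 → Fin 3)
    (h : ∀ i j, 0 < B i j → f i < f j) : IsAcyclic B := by
  intro i hi
  have : ∀ j, Relation.TransGen (fun a b => 0 < B a b) i j → f i < f j := fun j hj => by
    induction hj with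
    | single hij => exact h _ _ hij
    | tail _ hij ih => exact ih.trans (h _ _ hij)
  exact lt_irrefl _ (this i hi)

theorem not_isAcyclic_of_cycle {B : Matrix (Fin 3) (Fin 3) ℝ} {i j k : Fin 3} (h1 : 0 < B i j)
    (h2 : 0 < B j k) (h3 : 0 < B k i) : ¬ IsAcyclic B := fun h =>
  h i (((Relation.TransGen.single (r := fun a b => 0 < B a b) h1).tail h2).tail h3)

theorem isAcyclic_of_transitive {B : Matrix (Fin 3) (Fin 3) ℝ} (hB : ∀ i j, B j i = -B i j)
    (ρ : Equiv.Perm (Fin 3)) (h1 : 0 < B (ρ 0) (ρ 1)) (h2 : 0 < B (ρ 1) (ρ 2))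
    (h3 : 0 < B (ρ 0) (ρ 2)) : IsAcyclic B := by
  refine isAcyclic_of_rank ρ.symm fun i j hij => ?_
  obtain ⟨i, rfl⟩ := ρ.surjective i
  obtain ⟨j, rfl⟩ := ρ.surjective j
  rw [Equiv.symm_apply_apply, Equiv.symm_apply_apply]
  have h00 (i : Fin 3) : B i i = 0 := by have := hB i i; linarith
  have e1 := hB (ρ 0) (ρ 1)
  have e2 := hB (ρ 1) (ρ 2)
  have e3 := hB (ρ 0) (ρ 2)
  have key : ∀ i j : Fin 3, i < j ∨ i = j ∨ (i, j) = (1, 0) ∨ (i, j) = (2, 1) ∨ (i, j) = (2, 0) := by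
    decide
  rcases key i j with h | rfl | h | h | h
  · exact h
  · rw [h00] at hij; exact absurd hij (lt_irrefl _)
  all_goals
    simp only [Prod.mk.injEq] at h
    obtain ⟨rfl, rfl⟩ := h
    exfalso
    linarith

/-- Three vertices with an arrow between any two are either linearly ordered by the arrows or form
one of the two oriented cycles. -/
theorem tournament {B : Matrix (Fin 3) (Fin 3) ℝ} (hB : ∀ i j, B j i = -B i j)
    (h0 : ∀ i j, i ≠ j → B i j ≠ 0) :
    (∃ ρ : Equiv.Perm (Fin 3), 0 < B (ρ 0) (ρ 1) ∧ 0 < B (ρ 1) (ρ 2) ∧ 0 < B (ρ 0) (ρ 2)) ∨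
    (0 < B 0 1 ∧ 0 < B 1 2 ∧ 0 < B 2 0) ∨ (0 < B 1 0 ∧ 0 < B 2 1 ∧ 0 < B 0 2) := by
  have pos (i j : Fin 3) (h : i ≠ j) : 0 < B i j ∨ 0 < B j i := by
    rcases lt_or_gt_of_ne (h0 i j h) with h | h
    · right; rw [hB]; linarith
    · exact .inl h
  have s10 : Equiv.swap (1 : Fin 3) 2 0 = 0 := rfl
  have s02 : Equiv.swap (0 : Fin 3) 1 2 = 2 := rfl
  have s01 : Equiv.swap (0 : Fin 3) 2 1 = 1 := rfl
  have r0 : rot 0 = 2 := rfl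
  have r1 : rot 1 = 0 := rfl
  have r2 : rot 2 = 1 := rfl
  have i0 : finRotate 3 0 = 1 := rfl
  have i1 : finRotate 3 1 = 2 := rfl
  have i2 : finRotate 3 2 = 0 := rfl
  rcases pos 0 1 (by decide) with h | h <;> rcases pos 1 2 (by decide) with h' | h' <;>
    rcases pos 0 2 (by decide) with h'' | h''
  · exact .inl ⟨1, h, h', h''⟩
  · exact .inr (.inl ⟨h, h', h''⟩)
  · exact .inl ⟨Equiv.swap 1 2, by simp [s10, h, h', h'']⟩
  · exact .inl ⟨rot, by simp [r0, r1, r2, h, h', h'']⟩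
  · exact .inl ⟨Equiv.swap 0 1, by simp [s02, h, h', h'']⟩
  · exact .inl ⟨finRotate 3, by simp [i0, i1, i2, h, h', h'']⟩
  · exact .inr (.inr ⟨h, h', h''⟩)
  · exact .inl ⟨Equiv.swap 0 2, by simp [s01, h, h', h'']⟩

theorem exists_cycle_at {B : Matrix (Fin 3) (Fin 3) ℝ}
    (h : (0 < B 0 1 ∧ 0 < B 1 2 ∧ 0 < B 2 0) ∨ (0 < B 1 0 ∧ 0 < B 2 1 ∧ 0 < B 0 2)) (j : Fin 3) :
    ∃ ρ : Equiv.Perm (Fin 3), ρ 1 = j ∧ 0 < B (ρ 0) (ρ 1) ∧ 0 < B (ρ 1) (ρ 2) ∧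
      0 < B (ρ 2) (ρ 0) := by
  have s10 : Equiv.swap (1 : Fin 3) 2 0 = 0 := rfl
  have s02 : Equiv.swap (0 : Fin 3) 1 2 = 2 := rfl
  have s01 : Equiv.swap (0 : Fin 3) 2 1 = 1 := rfl
  have r0 : rot 0 = 2 := rfl
  have r1 : rot 1 = 0 := rfl
  have r2 : rot 2 = 1 := rfl
  have i0 : finRotate 3 0 = 1 := rfl
  have i1 : finRotate 3 1 = 2 := rfl
  have i2 : finRotate 3 2 = 0 := rfl
  rcases h with ⟨h1, h2, h3⟩ | ⟨h1, h2, h3⟩ <;> fin_cases j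
  · exact ⟨rot, by simp [r0, r1, r2, h1, h2, h3]⟩
  · exact ⟨1, by simp [h1, h2, h3]⟩
  · exact ⟨finRotate 3, by simp [i0, i1, i2, h1, h2, h3]⟩
  · exact ⟨Equiv.swap 0 1, by simp [s02, h1, h2, h3]⟩
  · exact ⟨Equiv.swap 0 2, by simp [s01, h1, h2, h3]⟩
  · exact ⟨Equiv.swap 1 2, by simp [s10, h1, h2, h3]⟩

namespace State

variable {n : ℕ} {F : Frame} {K : ℝ} (s : State n)

theorem seed_B_skew (i j : Fin 3) : (s.seed F K).B j i = -(s.seed F K).B i j := skew_skew _ _ _ i j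

/-- The arrows 0 → 1 → 2 are always present, so everything depends on the sign of cos(A + C). -/
theorem isAcyclic_seed_iff : Seed.IsAcyclic ⟦s.seed F K⟧ ↔ ¬ s.a + s.c ≤ n := by
  have h01 : 0 < (s.seed F K).B 0 1 := mul_pos two_pos s.cos_c_pos
  have h12 : 0 < (s.seed F K).B 1 2 := mul_pos two_pos s.cos_a_pos
  constructor
  · rintro ⟨x, hx, h⟩ hs
    obtain ⟨σ, e⟩ := (LabelledSeed.mk_eq_iff _ _).1 hx
    have h' := isAcyclic_submatrix σ h
    have e' : x.B.submatrix σ σ = (s.seed F K).B := by rw [e]; rfl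
    rw [e'] at h'
    refine not_isAcyclic_of_cycle h01 h12 ?_ h'
    change 0 < -(-(2 * Real.cos _))
    have := s.cos_add_pos hs
    linarith
  · intro hs
    refine ⟨_, rfl, isAcyclic_of_transitive s.seed_B_skew 1 h01 h12 ?_⟩
    change 0 < -(2 * Real.cos _)
    have := s.cos_add_neg hs
    linarith

/-- A standard seed can be mutated at a source exactly if it is acyclic. -/
theorem source_step_iff (hK : 0 < K) (q : Seed) :
    (∃ (x : LabelledSeed) (k : Fin 3), (⟦x⟧ : Seed) = ⟦s.seed F K⟧ ∧ IsSource x.B k ∧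
      (⟦x.mutate F.pos k⟧ : Seed) = q) ↔
      ¬ s.a + s.c ≤ n ∧ q = ⟦(s.mutate K 0).seed F K⟧ := by
  have h10 : (s.seed F K).B 1 0 < 0 := neg_lt_zero.2 (mul_pos two_pos s.cos_c_pos)
  have h21 : (s.seed F K).B 2 1 < 0 := neg_lt_zero.2 (mul_pos two_pos s.cos_a_pos)
  constructor
  · rintro ⟨x, k, e, hk, rfl⟩
    obtain ⟨σ, rfl⟩ := (LabelledSeed.mk_eq_iff _ _).1 e.symm
    rw [LabelledSeed.perm_mutate, LabelledSeed.mk_perm, mk_seed_mutate _ hK]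
    have hk' : IsSource (s.seed F K).B (σ k) := fun i => by
      have := hk (σ.symm i)
      simpa [LabelledSeed.perm] using this
    generalize σ k = l at hk'
    fin_cases l
    · refine ⟨fun hs => ?_, rfl⟩
      have h1 : 0 ≤ -(2 * Real.cos _) := hk' 2
      have h2 := s.cos_add_pos hs
      linarith
    · exact absurd (hk' 0) (not_le.2 h10)
    · exact absurd (hk' 1) (not_le.2 h21)
  · rintro ⟨hs, rfl⟩
    refine ⟨_, 0, rfl, fun i => ?_, mk_seed_mutate _ hK 0⟩
    fin_cases i
    · exact le_refl (0 : ℝ)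
    · exact (mul_pos two_pos s.cos_c_pos).le
    · change 0 ≤ -(2 * Real.cos _)
      have := s.cos_add_neg hs
      linarith

end State

/-! ### Quivers with prescribed angles -/

theorem IsQuiverOf.abs_eq {θ : Fin 3 → ℝ} {Q : Matrix (Fin 3) (Fin 3) ℝ} (h : IsQuiverOf θ Q)
    {i j k : Fin 3} (hij : i ≠ j) (hjk : j ≠ k) (hik : i ≠ k) :
    |Q i j| = 2 * |Real.cos (θ k)| := by
  have key : ∀ i j k : Fin 3, i ≠ j → j ≠ k → i ≠ k →
      (i = k + 1 ∧ j = k + 2) ∨ (j = k + 1 ∧ i = k + 2) := by decide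
  rcases key i j k hij hjk hik with ⟨rfl, rfl⟩ | ⟨rfl, rfl⟩
  · exact h.weight k
  · rw [h.skew, abs_neg]; exact h.weight k

/-- The quivers on the sides of a triangle with given angles are those of standard seeds. -/
theorem IsQuiverOf.exists_perm {n : ℕ} {m : Fin 3 → ℕ} {Q : Matrix (Fin 3) (Fin 3) ℝ}
    (hm : m 0 + m 1 + m 2 = 2 * n + 1) (hg : Nat.gcd (m 0) (Nat.gcd (m 1) (m 2)) = 1)
    (hQ : IsQuiverOf (fun i => m i * fundAngle n) Q) :
    ∃ (σ : Equiv.Perm (Fin 3)) (a c : ℕ), 1 ≤ a ∧ a ≤ n ∧ c ≤ n ∧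
      Nat.gcd (Nat.gcd a c) (2 * n + 1) = 1 ∧
      ∀ (F : Frame) (K : ℝ) (s : State n), s.a = a → s.c = c →
        (∀ i, s.ang (σ i) = m i) ∧ (s.seed F K).B.submatrix σ σ = Q := by
  have hsum (ρ : Equiv.Perm (Fin 3)) : m (ρ 0) + m (ρ 1) + m (ρ 2) = 2 * n + 1 := by
    rw [← hm, ← Fin.sum_univ_three fun i => m (ρ i), ← Fin.sum_univ_three m]
    exact Equiv.sum_comp ρ m
  -- A common divisor of two angles and of the sum 2n + 1 divides the third, which turns coprimality
  -- of the triple into the gcd condition on (a, c).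
  have hdvd (ρ : Equiv.Perm (Fin 3)) (d : ℕ) (h0 : d ∣ m (ρ 0)) (h2 : d ∣ m (ρ 2))
      (h : d ∣ 2 * n + 1) : d = 1 := by
    have h1 : d ∣ m (ρ 1) := by
      have e : m (ρ 0) + m (ρ 1) + m (ρ 2) = m (ρ 1) + (m (ρ 0) + m (ρ 2)) := by ring
      rw [← hsum ρ, e] at h
      exact (Nat.dvd_add_left (dvd_add h0 h2)).1 h
    have all (i : Fin 3) : d ∣ m i := by
      obtain ⟨i, rfl⟩ := ρ.surjective i
      fin_cases i <;> assumption
    exact Nat.dvd_one.1 (hg ▸ Nat.dvd_gcd (all 0) (Nat.dvd_gcd (all 1) (all 2)))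
  have hle (i : Fin 3) : m i ≤ 2 * n + 1 := by fin_cases i <;> simp <;> omega
  have hcos (k : Fin 3) : Real.cos (m k * fundAngle n) ≠ 0 := by
    by_cases h : m k ≤ n
    · exact (cos_mul_fundAngle_pos h).ne'
    · exact (cos_mul_fundAngle_neg (by omega) (hle k)).ne
  have third : ∀ i j : Fin 3, i ≠ j → ∃ k, j ≠ k ∧ i ≠ k := by decide
  have h0 (i j : Fin 3) (hij : i ≠ j) : Q i j ≠ 0 := by
    obtain ⟨k, hjk, hik⟩ := third i j hij
    have := hQ.abs_eq hij hjk hik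
    rw [← abs_ne_zero, this]
    have := abs_pos.2 (hcos k)
    positivity
  -- It suffices to label the sides so that the arrows are those of a standard seed and the entry
  -- and exit angles lie in the admissible range.
  have main (ρ : Equiv.Perm (Fin 3)) (h0 : 1 ≤ m (ρ 0)) (h0' : m (ρ 0) ≤ n) (h2 : m (ρ 2) ≤ n)
      (p01 : 0 < Q (ρ 0) (ρ 1)) (p12 : 0 < Q (ρ 1) (ρ 2))
      (p02 : Q (ρ 0) (ρ 2) = 2 * Real.cos (m (ρ 1) * fundAngle n)) :
      ∃ (σ : Equiv.Perm (Fin 3)) (a c : ℕ), 1 ≤ a ∧ a ≤ n ∧ c ≤ n ∧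
      Nat.gcd (Nat.gcd a c) (2 * n + 1) = 1 ∧
      ∀ (F : Frame) (K : ℝ) (s : State n), s.a = a → s.c = c →
        (∀ i, s.ang (σ i) = m i) ∧ (s.seed F K).B.submatrix σ σ = Q := by
    refine ⟨ρ.symm, m (ρ 0), m (ρ 2), h0, h0', h2, ?_, ?_⟩
    · refine hdvd ρ _ ?_ ?_ (Nat.gcd_dvd_right _ _)
      · exact (Nat.gcd_dvd_left _ _).trans (Nat.gcd_dvd_left _ _)
      · exact (Nat.gcd_dvd_left _ _).trans (Nat.gcd_dvd_right _ _)
    · intro F K s ha hc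
      have hs := hsum ρ
      constructor
      · intro i
        obtain ⟨i, rfl⟩ := ρ.surjective i
        rw [Equiv.symm_apply_apply]
        fin_cases i
        · exact ha
        · change 2 * n + 1 - (s.a + s.c) = m (ρ 1)
          omega
        · exact hc
      · have inj := ρ.injective
        have e01 : Q (ρ 0) (ρ 1) = 2 * Real.cos (s.c * fundAngle n) := by
          have := hQ.abs_eq (i := ρ 0) (j := ρ 1) (k := ρ 2) (inj.ne (by decide))
            (inj.ne (by decide)) (inj.ne (by decide))
          rwa [abs_of_pos p01, abs_of_pos (cos_mul_fundAngle_pos h2), ← hc] at this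
        have e12 : Q (ρ 1) (ρ 2) = 2 * Real.cos (s.a * fundAngle n) := by
          have := hQ.abs_eq (i := ρ 1) (j := ρ 2) (k := ρ 0) (inj.ne (by decide))
            (inj.ne (by decide)) (inj.ne (by decide))
          rwa [abs_of_pos p12, abs_of_pos (cos_mul_fundAngle_pos h0'), ← ha] at this
        have e02 : Q (ρ 0) (ρ 2) = -(2 * Real.cos (s.a * fundAngle n + s.c * fundAngle n)) := by
          have : m (ρ 1) = 2 * n + 1 - (s.a + s.c) := by omega
          rw [p02, this, sub_mul_fundAngle s.add_le, Real.cos_pi_sub, s.angle_add]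
          ring
        have hd (i : Fin 3) : Q i i = 0 := by have := hQ.skew i i; linarith
        ext i j
        obtain ⟨i, rfl⟩ := ρ.surjective i
        obtain ⟨j, rfl⟩ := ρ.surjective j
        rw [Matrix.submatrix_apply, Equiv.symm_apply_apply, Equiv.symm_apply_apply]
        fin_cases i <;> fin_cases j
        · exact (hd _).symm
        · exact e01.symm
        · exact e02.symm
        · exact ((hQ.skew _ _).trans (congrArg _ e01)).symm
        · exact (hd _).symm
        · exact e12.symm
        · exact ((hQ.skew _ _).trans (congrArg _ e02)).symm
        · exact ((hQ.skew _ _).trans (congrArg _ e12)).symm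
        · exact (hd _).symm
  have abs02 (ρ : Equiv.Perm (Fin 3)) :
      |Q (ρ 0) (ρ 2)| = 2 * |Real.cos (m (ρ 1) * fundAngle n)| :=
    hQ.abs_eq (ρ.injective.ne (by decide)) (ρ.injective.ne (by decide))
      (ρ.injective.ne (by decide))
  by_cases hobt : ∃ j, n + 1 ≤ m j
  · obtain ⟨j, hj⟩ := hobt
    have hna := hQ.obtuse ⟨j, half_pi_lt_mul_fundAngle hj⟩
    have hcyc := (tournament hQ.skew h0).resolve_left fun ⟨ρ, h1, h2, h3⟩ =>
      hna (isAcyclic_of_transitive hQ.skew ρ h1 h2 h3)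
    -- Rotate the cycle so that the obtuse angle is opposite the middle side.
    obtain ⟨ρ, rfl, p01, p12, p20⟩ := exists_cycle_at hcyc j
    have hs := hsum ρ
    have h02 : Q (ρ 0) (ρ 2) < 0 := by rw [hQ.skew]; linarith
    refine main ρ ?_ (by omega) (by omega) p01 p12 ?_
    -- If the entry angle were 0, side `ρ 0` would be the finite side. The convention for infinite
    -- regions then demands an arrow from it to `ρ 2`, against the cycle. So a zero angle can only
    -- be the exit angle.
    · by_contra hz
      have hz : m (ρ 0) = 0 := by omega
      have := hQ.infinite (ρ 0) (ρ 1) (ρ 2) (ρ.injective.ne (by decide))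
        (ρ.injective.ne (by decide)) (ρ.injective.ne (by decide)) (by simp [hz])
        (half_pi_lt_mul_fundAngle hj)
      linarith
    · have := abs02 ρ
      rw [abs_of_neg h02, abs_of_neg (cos_mul_fundAngle_neg hj (hle _))] at this
      linarith
  · push Not at hobt
    have hac := hQ.acute fun i => mul_fundAngle_lt_half_pi (by have := hobt i; omega)
    rcases tournament hQ.skew h0 with ⟨ρ, p01, p12, p02⟩ | ⟨h1, h2, h3⟩ | ⟨h1, h2, h3⟩
    · have hs := hsum ρ
      have b0 := hobt (ρ 0)
      have b1 := hobt (ρ 1)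
      have b2 := hobt (ρ 2)
      refine main ρ (by omega) (by omega) (by omega) p01 p12 ?_
      have := abs02 ρ
      rwa [abs_of_pos p02, abs_of_pos (cos_mul_fundAngle_pos (by omega))] at this
    · exact absurd hac (not_isAcyclic_of_cycle h1 h2 h3)
    · exact absurd hac (not_isAcyclic_of_cycle h3 h2 h1)


/-! ### Altitudes of a triangle -/

section Altitude

theorem inner_component_self {p q : Plane} {c s : ℝ} (hq : 0 < ‖q‖)
    (hc : inner ℝ p q = c * (‖p‖ * ‖q‖)) (h1 : s ^ 2 + c ^ 2 = 1) :
    inner ℝ ((c * ‖p‖ / ‖q‖) • q - p) ((c * ‖p‖ / ‖q‖) • q - p) = (‖p‖ * s) ^ 2 := by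
  rw [inner_sub_left, inner_sub_right, inner_sub_right, real_inner_smul_left, real_inner_smul_left,
    real_inner_smul_right, real_inner_smul_right, real_inner_comm p q, hc,
    real_inner_self_eq_norm_sq, real_inner_self_eq_norm_sq]
  field_simp
  linear_combination -‖p‖ ^ 2 * h1

theorem inner_component {p q : Plane} {c s : ℝ} (hp : 0 < ‖p‖) (hq : 0 < ‖q‖)
    (hc : inner ℝ p q = c * (‖p‖ * ‖q‖)) (h1 : s ^ 2 + c ^ 2 = 1) :
    inner ℝ ((c * ‖p‖ / ‖q‖) • q - p) ((c * ‖q‖ / ‖p‖) • p - q) =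
      -(c * (‖p‖ * s * (‖q‖ * s))) := by
  rw [inner_sub_left, inner_sub_right, inner_sub_right, real_inner_smul_left, real_inner_smul_left,
    real_inner_smul_right, real_inner_smul_right, real_inner_comm p q, hc,
    real_inner_self_eq_norm_sq, real_inner_self_eq_norm_sq]
  field_simp
  linear_combination c * h1

variable (Δ : Affine.Triangle ℝ Plane) {i j k : Fin 3}

theorem inner_altitude (h : j ≠ i) :
    inner ℝ (Δ.altitudeFoot i - Δ.points i) (Δ.points j - Δ.altitudeFoot i) = (0 : ℝ) := by
  have := Affine.Simplex.inner_vsub_altitudeFoot_vsub_altitudeFoot_eq_zero Δ h.symm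
  simp only [vsub_eq_sub] at this
  rw [real_inner_comm, ← neg_sub (Δ.points i), inner_neg_right, this, neg_zero]

theorem exists_altitudeFoot_eq (hij : i ≠ j) (hjk : j ≠ k) (hik : i ≠ k) :
    ∃ r : ℝ, Δ.altitudeFoot i - Δ.points k = r • (Δ.points j - Δ.points k) := by
  have h := Δ.altitudeFoot_mem_affineSpan_image_compl i
  have key : ∀ i j k : Fin 3, i ≠ j → j ≠ k → i ≠ k → ∀ l, l ≠ i ↔ l = k ∨ l = j := by decide
  have e : Δ.points '' {i}ᶜ = {Δ.points k, Δ.points j} := by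
    have : ({i}ᶜ : Set (Fin 3)) = {k, j} := by
      ext l
      simpa using key i j k hij hjk hik l
    rw [this, Set.image_pair]
  rw [e] at h
  obtain ⟨r, hr⟩ := mem_affineSpan_pair_iff_exists_lineMap_eq.1 h
  refine ⟨r, ?_⟩
  rw [← hr, AffineMap.lineMap_apply]
  simp

theorem altitude_eq (hij : i ≠ j) (hjk : j ≠ k) (hik : i ≠ k) :
    Δ.altitudeFoot i - Δ.points i =
      (Real.cos (∠ (Δ.points i) (Δ.points k) (Δ.points j)) * ‖Δ.points i - Δ.points k‖ /
        ‖Δ.points j - Δ.points k‖) • (Δ.points j - Δ.points k) -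
      (Δ.points i - Δ.points k) := by
  obtain ⟨r, hr⟩ := exists_altitudeFoot_eq Δ hij hjk hik
  have hq : 0 < ‖Δ.points j - Δ.points k‖ :=
    norm_pos_iff.2 (sub_ne_zero.2 (Δ.independent.injective.ne hjk))
  have h0 : inner ℝ (Δ.altitudeFoot i - Δ.points i) (Δ.points j - Δ.points k) = (0 : ℝ) := by
    have h1 := inner_altitude Δ hij.symm
    have h2 := inner_altitude Δ hik.symm
    rw [← sub_sub_sub_cancel_right (Δ.points j) (Δ.points k) (Δ.altitudeFoot i), inner_sub_right,
      h1, h2, sub_zero]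
  have e : Δ.altitudeFoot i - Δ.points i =
      r • (Δ.points j - Δ.points k) - (Δ.points i - Δ.points k) := by rw [← hr]; abel
  rw [e, inner_sub_left, real_inner_smul_left, real_inner_self_eq_norm_sq] at h0
  have hc : inner ℝ (Δ.points i - Δ.points k) (Δ.points j - Δ.points k) =
      Real.cos (∠ (Δ.points i) (Δ.points k) (Δ.points j)) *
        (‖Δ.points i - Δ.points k‖ * ‖Δ.points j - Δ.points k‖) :=
    (InnerProductGeometry.cos_angle_mul_norm_mul_norm _ _).symm
  rw [hc] at h0
  rw [e]
  congr 2
  field_simp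
  have := mul_left_cancel₀ hq.ne' (show ‖Δ.points j - Δ.points k‖ *
    (r * ‖Δ.points j - Δ.points k‖) = ‖Δ.points j - Δ.points k‖ *
    (Real.cos (∠ (Δ.points i) (Δ.points k) (Δ.points j)) * ‖Δ.points i - Δ.points k‖) by
      linear_combination h0)
  exact this

theorem norm_altitude (hij : i ≠ j) (hjk : j ≠ k) (hik : i ≠ k) :
    ‖Δ.altitudeFoot i - Δ.points i‖ =
      ‖Δ.points i - Δ.points k‖ * Real.sin (∠ (Δ.points i) (Δ.points k) (Δ.points j)) := by
  have hq : 0 < ‖Δ.points j - Δ.points k‖ :=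
    norm_pos_iff.2 (sub_ne_zero.2 (Δ.independent.injective.ne hjk))
  have hc : inner ℝ (Δ.points i - Δ.points k) (Δ.points j - Δ.points k) =
      Real.cos (∠ (Δ.points i) (Δ.points k) (Δ.points j)) *
        (‖Δ.points i - Δ.points k‖ * ‖Δ.points j - Δ.points k‖) :=
    (InnerProductGeometry.cos_angle_mul_norm_mul_norm _ _).symm
  have hs : 0 ≤ Real.sin (∠ (Δ.points i) (Δ.points k) (Δ.points j)) :=
    InnerProductGeometry.sin_angle_nonneg _ _
  have h1 := Real.sin_sq_add_cos_sq (∠ (Δ.points i) (Δ.points k) (Δ.points j))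
  refine (sq_eq_sq₀ (norm_nonneg _) (by positivity)).1 ?_
  rw [altitude_eq Δ hij hjk hik, ← real_inner_self_eq_norm_sq]
  exact inner_component_self hq hc h1

/-- The altitudes, directed from vertex to foot, are outward normals of the sides; hence their angle
is the supplement of the interior one. -/
theorem inner_altitude_altitude (hij : i ≠ j) (hjk : j ≠ k) (hik : i ≠ k) :
    inner ℝ (Δ.altitudeFoot i - Δ.points i) (Δ.altitudeFoot j - Δ.points j) =
      -(Real.cos (∠ (Δ.points i) (Δ.points k) (Δ.points j)) *
        (‖Δ.altitudeFoot i - Δ.points i‖ * ‖Δ.altitudeFoot j - Δ.points j‖)) := by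
  have hq : 0 < ‖Δ.points j - Δ.points k‖ :=
    norm_pos_iff.2 (sub_ne_zero.2 (Δ.independent.injective.ne hjk))
  have hp : 0 < ‖Δ.points i - Δ.points k‖ :=
    norm_pos_iff.2 (sub_ne_zero.2 (Δ.independent.injective.ne hik))
  have hc : inner ℝ (Δ.points i - Δ.points k) (Δ.points j - Δ.points k) =
      Real.cos (∠ (Δ.points i) (Δ.points k) (Δ.points j)) *
        (‖Δ.points i - Δ.points k‖ * ‖Δ.points j - Δ.points k‖) :=
    (InnerProductGeometry.cos_angle_mul_norm_mul_norm _ _).symm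
  have hcomm : ∠ (Δ.points j) (Δ.points k) (Δ.points i) =
      ∠ (Δ.points i) (Δ.points k) (Δ.points j) := EuclideanGeometry.angle_comm _ _ _
  have h1 := Real.sin_sq_add_cos_sq (∠ (Δ.points i) (Δ.points k) (Δ.points j))
  rw [norm_altitude Δ hij hjk hik, norm_altitude Δ hij.symm hik hjk,
    altitude_eq Δ hij hjk hik, altitude_eq Δ hij.symm hik hjk, hcomm]
  exact inner_component hp hq hc h1

theorem altitude_ne_zero (i : Fin 3) : ‖Δ.altitudeFoot i - Δ.points i‖ ≠ 0 :=
  norm_ne_zero_iff.2 (sub_ne_zero.2 (Δ.ne_altitudeFoot i).symm)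

theorem sideFun_form_self (i : Fin 3) : (sideFun Δ i).form (sideFun Δ i) = 2 := by
  have h := altitude_ne_zero Δ i
  have h2 : √2 ^ 2 = (2 : ℝ) := Real.sq_sqrt (by norm_num)
  simp only [sideFun, AffFun.form]
  rw [real_inner_smul_left, real_inner_smul_right, real_inner_self_eq_norm_sq]
  field_simp
  exact h2

theorem sideFun_form (hij : i ≠ j) (hjk : j ≠ k) (hik : i ≠ k) :
    (sideFun Δ i).form (sideFun Δ j) =
      -(2 * Real.cos (∠ (Δ.points i) (Δ.points k) (Δ.points j))) := by
  have hi := altitude_ne_zero Δ i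
  have hj := altitude_ne_zero Δ j
  have h2 : √2 ^ 2 = (2 : ℝ) := Real.sq_sqrt (by norm_num)
  simp only [sideFun, AffFun.form, real_inner_smul_left, real_inner_smul_right,
    inner_altitude_altitude Δ hij hjk hik]
  field_simp
  rw [h2]
  ring

theorem sideFun_eval_foot (i : Fin 3) : (sideFun Δ i).eval (Δ.altitudeFoot i) = 0 := by
  simp [sideFun, AffFun.eval]

theorem sideFun_eval_point (h : j ≠ i) : (sideFun Δ i).eval (Δ.points j) = 0 := by
  have := inner_altitude Δ h
  rw [inner_sub_right] at this
  simp only [sideFun, AffFun.eval, real_inner_smul_left]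
  linear_combination (√2 / ‖Δ.altitudeFoot i - Δ.points i‖) * this

/-- The function of side `i` vanishes at the vertex `j`; along the altitude from there it changes by
the scalar product of the two normals, suitably scaled. -/
theorem sideFun_eval_foot_of_ne (h : j ≠ i) : (sideFun Δ i).eval (Δ.altitudeFoot j) =
    ‖Δ.altitudeFoot j - Δ.points j‖ / √2 * (sideFun Δ i).form (sideFun Δ j) := by
  have h0 := sideFun_eval_point Δ h
  have hj := altitude_ne_zero Δ j
  have h2 : (√2 : ℝ) ≠ 0 := by positivity
  have e : (sideFun Δ i).form (sideFun Δ j) =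
      √2 / ‖Δ.altitudeFoot j - Δ.points j‖ *
        inner ℝ (sideFun Δ i).1 (Δ.altitudeFoot j - Δ.points j) := by
    rw [AffFun.form]
    conv_lhs => rw [show (sideFun Δ j).1 = (√2 / ‖Δ.altitudeFoot j - Δ.points j‖) •
      (Δ.altitudeFoot j - Δ.points j) from rfl]
    rw [real_inner_smul_right]
  rw [e, inner_sub_right]
  rw [AffFun.eval] at h0 ⊢
  field_simp
  linarith

end Altitude

/-! ### The initial seed as a standard seed -/

theorem Frame.eq_fn (F : Frame) {f : AffFun} {X Y Z : ℝ} (hX : inner ℝ (F.b 0) f.1 = √2 * X)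
    (hY : inner ℝ (F.b 1) f.1 = √2 * Y) (hZ : f.eval F.O = √2 * Z) : f = F.fn X Y Z := by
  have h : √2 • (X • F.b 0 + Y • F.b 1) = f.1 := by
    conv_rhs => rw [F.vec_eq f.1, hX, hY]
    module
  rw [fn, h, ← hZ]
  simp [AffFun.eval]

/-- The parameters of the initial seed. -/
def initialState (n : ℕ) (hn : 1 ≤ n) : State n where
  a := 1
  c := n
  ε := 1
  x := 0
  one_le_a := le_rfl
  a_le := hn
  c_le := le_rfl
  ε_sq := one_pow 2

/-- Everything reduces to the initial triangle being standard with origin at the altitude foot on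
the base and K equal to this altitude times sin α. -/
theorem exists_frame {n : ℕ} (hn : 1 ≤ n) {Δ : Affine.Triangle ℝ Plane}
    (hΔ : IsInitialTriangle n Δ) :
    ∃ (F : Frame) (K : ℝ), 0 < K ∧ initialLabelledSeed n Δ = (initialState n hn).seed F K ∧
      positive Δ = F.pos ∧ beltLine Δ = F.axis ∧ ‖beltVector Δ‖⁻¹ • beltVector Δ = F.b 0 := by
  obtain ⟨t0, t1, t2⟩ := hΔ
  set A := fundAngle n with hA
  set C := n * fundAngle n with hC
  have hAC : A + C = Real.pi - C := by
    have := mul_fundAngle n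
    rw [hC, hA]; linarith
  have hcosAC : Real.cos (A + C) = -Real.cos C := by rw [hAC, Real.cos_pi_sub]
  have hS : 0 < Real.sin (A + C) := by
    have := (initialState n hn).sin_add_pos
    simpa [initialState] using this
  have hCC : 0 < Real.cos C := (initialState n hn).cos_c_pos
  have hsA : 0 < Real.sin A := by simpa [initialState] using (initialState n hn).sin_a_pos
  have hcA : 0 < Real.cos A := by simpa [initialState] using (initialState n hn).cos_a_pos
  have r2 : (0 : ℝ) < √2 := by positivity
  have r2' : √2 ^ 2 = (2 : ℝ) := Real.sq_sqrt (by norm_num)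
  have f01 : (sideFun Δ 0).form (sideFun Δ 1) = -(2 * Real.cos C) := by
    rw [sideFun_form Δ (k := 2) (by decide) (by decide) (by decide), t2]
  have f02 : (sideFun Δ 0).form (sideFun Δ 2) = 2 * Real.cos (A + C) := by
    rw [sideFun_form Δ (k := 1) (by decide) (by decide) (by decide), t1, hcosAC]; ring
  have f12 : (sideFun Δ 1).form (sideFun Δ 2) = -(2 * Real.cos A) := by
    rw [sideFun_form Δ (k := 0) (by decide) (by decide) (by decide), t0]
  have f00 := sideFun_form_self Δ 0
  have f22 := sideFun_form_self Δ 2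
  set H := ‖Δ.altitudeFoot 0 - Δ.points 0‖ with hH
  set H' := ‖Δ.altitudeFoot 2 - Δ.points 2‖ with hH'
  have hHpos : 0 < H := (norm_nonneg _).lt_of_ne' (altitude_ne_zero Δ 0)
  have hH'pos : 0 < H' := (norm_nonneg _).lt_of_ne' (altitude_ne_zero Δ 2)
  -- Both sides are the length of the leg between the vertices 0 and 2, times sin A sin C. This
  -- equality makes the line through the two feet parallel to `e`.
  have hHH' : H' * Real.sin C = H * Real.sin A := by
    rw [hH, hH', norm_altitude Δ (i := 0) (j := 1) (k := 2) (by decide) (by decide) (by decide),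
      norm_altitude Δ (i := 2) (j := 1) (k := 0) (by decide) (by decide) (by decide), t2,
      EuclideanGeometry.angle_comm, t0, norm_sub_rev]
    ring
  set p := (sideFun Δ 0).1 with hp
  set q := (sideFun Δ 2).1 with hq
  have ipp : inner ℝ p p = (2 : ℝ) := f00
  have iqq : inner ℝ q q = (2 : ℝ) := f22
  have ipq : inner ℝ p q = 2 * Real.cos (A + C) := f02
  have iqp : inner ℝ q p = 2 * Real.cos (A + C) := by rw [real_inner_comm]; exact ipq
  set D := √2 * Real.sin (A + C) with hD
  have hDpos : 0 < D := by positivity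
  -- The vectors `e`, `e'` solve p = √2(-sin A e + cos A e') and q = √2(sin C e + cos C e'), the
  -- linear parts required of the sides 0 and 2.
  set e : Plane := D⁻¹ • ((-Real.cos C) • p + Real.cos A • q) with he
  set e' : Plane := D⁻¹ • (Real.sin C • p + Real.sin A • q) with he'
  have ie (w : Plane) : inner ℝ e w =
      D⁻¹ * (-Real.cos C * inner ℝ p w + Real.cos A * inner ℝ q w) := by
    rw [he, real_inner_smul_left, inner_add_left, real_inner_smul_left, real_inner_smul_left]
  have ie' (w : Plane) : inner ℝ e' w =
      D⁻¹ * (Real.sin C * inner ℝ p w + Real.sin A * inner ℝ q w) := by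
    rw [he', real_inner_smul_left, inner_add_left, real_inner_smul_left, real_inner_smul_left]
  have cC : Real.cos C = Real.cos (A + C) * Real.cos A + Real.sin (A + C) * Real.sin A := by
    rw [← Real.cos_sub, add_sub_cancel_left]
  have sC : Real.sin C = Real.sin (A + C) * Real.cos A - Real.cos (A + C) * Real.sin A := by
    rw [← Real.sin_sub, add_sub_cancel_left]
  have cA : Real.cos A = Real.cos (A + C) * Real.cos C + Real.sin (A + C) * Real.sin C := by
    rw [← Real.cos_sub, add_sub_cancel_right]
  have sA : Real.sin A = Real.sin (A + C) * Real.cos C - Real.cos (A + C) * Real.sin C := by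
    rw [← Real.sin_sub, add_sub_cancel_right]
  have hA1 := Real.sin_sq_add_cos_sq A
  have hC1 := Real.sin_sq_add_cos_sq C
  have ep : inner ℝ e p = √2 * -Real.sin A := by
    rw [ie, ipp, iqp, hD]
    field_simp
    rw [r2']
    linear_combination -2 * cC
  have eq' : inner ℝ e q = √2 * Real.sin C := by
    rw [ie, ipq, iqq, hD]
    field_simp
    rw [r2']
    linear_combination 2 * cA
  have e'p : inner ℝ e' p = √2 * Real.cos A := by
    rw [ie', ipp, iqp, hD]
    field_simp
    rw [r2']
    linear_combination 2 * sC
  have e'q : inner ℝ e' q = √2 * Real.cos C := by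
    rw [ie', ipq, iqq, hD]
    field_simp
    rw [r2']
    linear_combination 2 * sA
  have ee : inner ℝ e e = (1 : ℝ) := by
    rw [ie, real_inner_comm, ep, real_inner_comm, eq', hD, Real.sin_add]
    rw [Real.sin_add] at hS
    field_simp
  have e'e' : inner ℝ e' e' = (1 : ℝ) := by
    rw [ie', real_inner_comm, e'p, real_inner_comm, e'q, hD, Real.sin_add]
    rw [Real.sin_add] at hS
    field_simp
    ring
  have ee' : inner ℝ e e' = (0 : ℝ) := by
    rw [ie, real_inner_comm, e'p, real_inner_comm, e'q]
    ring
  have hnorm : ‖e‖ = 1 := by rw [norm_eq_sqrt_real_inner, ee, Real.sqrt_one]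
  have hnorm' : ‖e'‖ = 1 := by rw [norm_eq_sqrt_real_inner, e'e', Real.sqrt_one]
  have hon : Orthonormal ℝ ![e, e'] := by
    rw [orthonormal_iff_ite]
    intro i j
    fin_cases i <;> fin_cases j <;> simp [hnorm, hnorm', ee', real_inner_comm e e']
  have hcard : Fintype.card (Fin 2) = Module.finrank ℝ Plane := by simp
  let b : OrthonormalBasis (Fin 2) ℝ Plane :=
    (basisOfOrthonormalOfCardEqFinrank hon hcard).toOrthonormalBasis (by
      rw [coe_basisOfOrthonormalOfCardEqFinrank]; exact hon)
  have hb : ⇑b = ![e, e'] := by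
    rw [Module.Basis.coe_toOrthonormalBasis, coe_basisOfOrthonormalOfCardEqFinrank]
  have hb0 : b 0 = e := by rw [hb]; rfl
  have hb1 : b 1 = e' := by rw [hb]; rfl
  let F : Frame := ⟨Δ.altitudeFoot 0, b⟩
  have hF0 : F.b 0 = e := hb0
  have hF1 : F.b 1 = e' := hb1
  have v1O : (sideFun Δ 1).eval (Δ.altitudeFoot 0) = √2 * (-(H * Real.cos C)) := by
    rw [sideFun_eval_foot_of_ne Δ (by decide), AffFun.form_comm, f01, ← hH]
    field_simp
    rw [r2']
  have v2O : (sideFun Δ 2).eval (Δ.altitudeFoot 0) = √2 * (H * Real.cos (A + C)) := by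
    rw [sideFun_eval_foot_of_ne Δ (by decide), AffFun.form_comm, f02, ← hH]
    field_simp
    rw [r2']
  have v0P : (sideFun Δ 0).eval (Δ.altitudeFoot 2) = √2 * (H' * Real.cos (A + C)) := by
    rw [sideFun_eval_foot_of_ne Δ (by decide), f02, ← hH']
    field_simp
    rw [r2']
  have pv : inner ℝ p (beltVector Δ) = √2 * (H' * Real.cos (A + C)) := by
    have h0 := sideFun_eval_foot Δ 0
    rw [AffFun.eval] at h0 v0P
    rw [beltVector, inner_sub_right]
    linarith
  have qv : inner ℝ q (beltVector Δ) = -(√2 * (H * Real.cos (A + C))) := by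
    have h0 := sideFun_eval_foot Δ 2
    rw [AffFun.eval] at h0 v2O
    rw [beltVector, inner_sub_right]
    linarith
  set d := D⁻¹ * (√2 * Real.cos C * (H' * Real.cos C + H * Real.cos A)) with hd
  have hdpos : 0 < d := by positivity
  have hbelt : beltVector Δ = d • e := by
    -- The component along `e'` is a multiple of H' sin C - H sin A and therefore vanishes.
    rw [F.vec_eq (beltVector Δ), hF0, hF1, ie, ie', pv, qv,
      show D⁻¹ * (Real.sin C * (√2 * (H' * Real.cos (A + C))) +
        Real.sin A * -(√2 * (H * Real.cos (A + C)))) =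
        D⁻¹ * √2 * Real.cos (A + C) * (H' * Real.sin C - H * Real.sin A) by ring, hHH', sub_self,
      mul_zero, zero_smul, add_zero, hd, hcosAC]
    congr 1
    ring
  refine ⟨F, H * Real.sin A, by positivity, ?_, ?_, ?_, ?_⟩
  · refine LabelledSeed.ext (funext fun i => ?_) ?_
    · fin_cases i
      · refine F.eq_fn ?_ ?_ ?_
        · change inner ℝ (F.b 0) p = _
          simpa [initialState, hF0, hA, hC] using ep
        · change inner ℝ (F.b 1) p = _
          simpa [initialState, hF1, hA, hC] using e'p
        · change (sideFun Δ 0).eval (Δ.altitudeFoot 0) = _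
          simpa [initialState] using sideFun_eval_foot Δ 0
      · refine F.eq_fn ?_ ?_ ?_
        · change inner ℝ (F.b 0) (sideFun Δ 1).1 = _
          have h1 : inner ℝ p (sideFun Δ 1).1 = -(2 * Real.cos C) := f01
          have h2 : inner ℝ q (sideFun Δ 1).1 = -(2 * Real.cos A) := by
            rw [real_inner_comm]; exact f12
          rw [hF0, ie, h1, h2]
          simp only [initialState, Nat.cast_one, one_mul]
          rw [hD, ← hA, ← hC]
          field_simp
          rw [r2', Real.sin_sub, Real.sin_add]
          linear_combination 2 * Real.cos A ^ 2 * hC1 - 2 * Real.cos C ^ 2 * hA1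
        · change inner ℝ (F.b 1) (sideFun Δ 1).1 = _
          have h1 : inner ℝ p (sideFun Δ 1).1 = -(2 * Real.cos C) := f01
          have h2 : inner ℝ q (sideFun Δ 1).1 = -(2 * Real.cos A) := by
            rw [real_inner_comm]; exact f12
          rw [hF1, ie', h1, h2]
          simp only [initialState, Nat.cast_one, one_mul]
          rw [hD, ← hA, ← hC]
          field_simp
          rw [r2', Real.cos_sub, Real.sin_add]
          linear_combination 2 * Real.sin A * Real.cos A * hC1 + 2 * Real.sin C * Real.cos C * hA1
        · change (sideFun Δ 1).eval (Δ.altitudeFoot 0) = _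
          rw [v1O]
          simp only [initialState, Nat.cast_one, one_mul]
          rw [← hA, ← hC]
          field_simp
          ring
      · refine F.eq_fn ?_ ?_ ?_
        · change inner ℝ (F.b 0) q = _
          simpa [initialState, hF0, hA, hC] using eq'
        · change inner ℝ (F.b 1) q = _
          simpa [initialState, hF1, hA, hC] using e'q
        · change (sideFun Δ 2).eval (Δ.altitudeFoot 0) = _
          rw [v2O]
          simp only [initialState, Nat.cast_one, one_mul]
          rw [← hA, ← hC]
          field_simp
          ring
    · change !![_, _, _; _, _, _; _, _, _] = skew _ _ _
      simp only [initialState, Nat.cast_one, one_mul, skew]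
      rw [← hA, ← hC, hcosAC, mul_neg, neg_neg]
  · have hpt (t : ℝ) : Δ.altitudeFoot 0 + t • beltVector Δ = F.pt (t * d) 0 := by
      rw [hbelt, Frame.pt, hF0, smul_smul, zero_smul, add_zero]
    ext f
    simp only [positive, Frame.pos, Set.mem_ofPred_eq, hpt]
    constructor
    · intro h
      have := (Filter.tendsto_id.atTop_mul_const (inv_pos.2 hdpos)).eventually h
      filter_upwards [this] with t ht
      simpa [mul_assoc, inv_mul_cancel₀ hdpos.ne'] using ht
    · intro h
      exact (Filter.tendsto_id.atTop_mul_const hdpos).eventually h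
  · ext z
    rw [beltLine, mem_affineSpan_pair_iff_exists_lineMap_eq, Frame.axis, AffineSubspace.mem_mk',
      Submodule.mem_span_singleton, hF0]
    have hv : Δ.altitudeFoot 2 -ᵥ Δ.altitudeFoot 0 = d • e := hbelt
    constructor
    · rintro ⟨r, rfl⟩
      refine ⟨r * d, ?_⟩
      rw [AffineMap.lineMap_apply, hv]
      simp [F, smul_smul]
    · rintro ⟨r, hr⟩
      refine ⟨r / d, ?_⟩
      rw [AffineMap.lineMap_apply, hv, smul_smul, div_mul_cancel₀ _ hdpos.ne', hr]
      simp [F]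
  · rw [hF0, hbelt, norm_smul, hnorm, mul_one, Real.norm_of_nonneg hdpos.le, smul_smul,
      inv_mul_cancel₀ hdpos.ne', one_smul]


/-! ### Glides and periods of the mutation class -/

namespace State

variable {n : ℕ} {K : ℝ} (s : State n)

theorem glide_one_zero : s.glide 1 0 (one_pow 2) = s := by
  ext <;> simp [glide]

theorem glide_glide {δ δ' η r r' q : ℝ} {hδ : δ ^ 2 = 1} {hδ' : δ' ^ 2 = 1} (hη : η ^ 2 = 1)
    (h : δ' * δ = η) (hq : r + r' = q) :
    (s.glide δ r hδ).glide δ' r' hδ' = s.glide η q hη := by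
  subst h hq
  ext <;> simp [glide] <;> ring

theorem mutOut_mutIn (h : ¬ s.a + s.c ≤ n) : (s.mutIn K).mutOut K = s := by
  have h1 := s.a_le
  have h2 := s.c_le
  have h3 : ¬ 2 * n + 1 - (s.a + s.c) + s.a ≤ n := by omega
  have h4 : 2 * n + 1 - (2 * n + 1 - (s.a + s.c) + s.a) = s.c := by omega
  ext <;> simp [mutIn, mutOut, h, h3, h4]

/-- Mutation of an acyclic seed at the vertex that is neither a source nor a sink yields a cyclic
seed. -/
theorem mutMid_le : (s.mutMid K).a + (s.mutMid K).c ≤ n := by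
  have h1 := s.a_le
  have h2 := s.c_le
  by_cases h : s.a ≤ s.c <;> simp [mutMid, h] <;> omega

/-- The translations along the belt line that preserve the mutation class of `o`. -/
def period (F : Frame) (hK : 0 < K) (o : State n) : AddSubgroup ℝ where
  carrier := {r | Orb K o (o.glide 1 r (one_pow 2))}
  zero_mem' := by
    change Orb K o (o.glide 1 0 _)
    rw [glide_one_zero]
    exact .refl
  add_mem' := by
    intro r q hr hq
    have h := Orb.glide_mem F hK .refl hq hr
    rw [glide_glide o (one_pow 2) (one_mul 1) rfl] at h
    exact h
  neg_mem' := by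
    intro r hr
    have h := Orb.glide hr 1 (-r) (one_pow 2)
    rw [glide_glide o (one_pow 2) (one_mul 1) (add_neg_cancel r), glide_one_zero] at h
    exact h.symm F hK

/-- Mutation commutes with translation along the axis, so one member of the class suffices to test
whether a translation preserves it. -/
theorem mem_period (F : Frame) {hK : 0 < K} {o : State n} {t : State n} {r : ℝ}
    (ht : Orb K o t) : r ∈ period F hK o ↔ Orb K o (t.glide 1 r (one_pow 2)) :=
  ⟨fun h => Orb.glide_mem F hK .refl h ht, fun h => Orb.glide_mem F hK ht h .refl⟩

end State

/-! ### The exchange graph, the lattice and the acyclic belts -/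

section Class

variable {n : ℕ} {hn : 1 ≤ n} {Δ : Affine.Triangle ℝ Plane} {F : Frame} {K : ℝ}

open State

theorem mem_mutationClass_iff (hK : 0 < K)
    (hinit : initialLabelledSeed n Δ = (initialState n hn).seed F K) (hpos : positive Δ = F.pos)
    (q : Seed) :
    q ∈ mutationClass n Δ ↔ ∃ t, Orb K (initialState n hn) t ∧ q = ⟦t.seed F K⟧ := by
  rw [← mem_class_iff hK, ← hinit, ← hpos]
  rfl

/-- Translations between seeds are along the axis and form a group already, so passing to absolute
values and then to the span changes nothing. -/
theorem lengthLattice_eq (hK : 0 < K)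
    (hinit : initialLabelledSeed n Δ = (initialState n hn).seed F K) (hpos : positive Δ = F.pos) :
    lengthLattice n Δ = period F hK (initialState n hn) := by
  have hb : ‖F.b 0‖ = 1 := F.b.orthonormal.1 0
  apply le_antisymm
  · rw [lengthLattice, AddSubgroup.closure_le]
    rintro l ⟨w, ⟨p, hp⟩, ⟨q, hq⟩, h, rfl⟩
    obtain ⟨s, hs, rfl⟩ := (mem_mutationClass_iff hK hinit hpos p).1 hp
    obtain ⟨t, ht, rfl⟩ := (mem_mutationClass_iff hK hinit hpos q).1 hq
    obtain ⟨r, rfl, rfl⟩ := seed_translate_eq h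
    have hr := (mem_period F (hK := hK) ht).2 hs
    rw [norm_smul, hb, mul_one, Real.norm_eq_abs]
    rcases abs_choice r with h | h <;> rw [h]
    · exact hr
    · exact neg_mem hr
  · intro r hr
    have h1 : |r| ∈ lengthLattice n Δ := by
      refine AddSubgroup.subset_closure ⟨r • F.b 0,
        ⟨_, (mem_mutationClass_iff hK hinit hpos _).2 ⟨_, hr, rfl⟩⟩,
        ⟨_, (mem_mutationClass_iff hK hinit hpos _).2 ⟨_, .refl, rfl⟩⟩, seed_glide_one _ r, ?_⟩
      rw [norm_smul, hb, mul_one, Real.norm_eq_abs]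
    rcases abs_choice r with h | h <;> rw [h] at h1
    · exact h1
    · simpa using neg_mem h1

theorem mem_translationLattice_iff (hK : 0 < K)
    (hinit : initialLabelledSeed n Δ = (initialState n hn).seed F K) (hpos : positive Δ = F.pos)
    (hunit : ‖beltVector Δ‖⁻¹ • beltVector Δ = F.b 0) (w : Plane) :
    w ∈ translationLattice n Δ ↔ ∃ r ∈ period F hK (initialState n hn), w = r • F.b 0 := by
  rw [translationLattice, lengthLattice_eq hK hinit hpos, hunit, AddSubgroup.mem_map]
  simp only [eq_comm (a := w)]
  rfl

/-- Adjacency in the exchange graph. -/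
theorem exchangeGraph_adj_iff (hK : 0 < K) (hpos : positive Δ = F.pos) {s t : State n}
    {p q : mutationClass n Δ} (hp : (p : Seed) = ⟦s.seed F K⟧) (hq : (q : Seed) = ⟦t.seed F K⟧) :
    (exchangeGraph n Δ).Adj p q ↔ s ≠ t ∧ ∃ k, t = s.mutate K k := by
  have rel {s t : State n} {p q : mutationClass n Δ} (hp : (p : Seed) = ⟦s.seed F K⟧)
      (hq : (q : Seed) = ⟦t.seed F K⟧) : (∃ (x : LabelledSeed) (k : Fin 3),
      (⟦x⟧ : Seed) = p ∧ (⟦x.mutate (positive Δ) k⟧ : Seed) = q) ↔ ∃ k, t = s.mutate K k := by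
    rw [hp, hq, hpos, step_iff s hK]
    exact exists_congr fun k => ⟨seed_injective, fun h => by rw [h]⟩
  have hne : p ≠ q ↔ s ≠ t := by
    rw [not_iff_not, ← Subtype.coe_inj, hp, hq]
    exact ⟨seed_injective, fun h => by rw [h]⟩
  rw [exchangeGraph, SimpleGraph.fromRel_adj, rel hp hq, rel hq hp, hne]
  refine and_congr_right fun _ => or_iff_left_of_imp ?_
  rintro ⟨k, rfl⟩
  obtain ⟨l, hl⟩ := exists_mutate_mutate t F hK k
  exact ⟨l, hl.symm⟩

/-- The source mutations of an acyclic seed generate an acyclic belt. -/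
theorem exists_belt (hK : 0 < K)
    (hinit : initialLabelledSeed n Δ = (initialState n hn).seed F K) (hpos : positive Δ = F.pos)
    {u : ℤ → State n} (hu : ∀ m, Orb K (initialState n hn) (u m))
    (hacute : ∀ m, ¬ (u m).a + (u m).c ≤ n) (hstep : ∀ m, u (m + 1) = (u m).mutate K 0) :
    ∃ f : SimpleGraph.hasse ℤ ↪g exchangeGraph n Δ,
      (∀ m, (f m : Seed) = ⟦(u m).seed F K⟧) ∧ IsAcyclicBelt n Δ (Set.range f) := by
  -- Source mutations always move the seed backwards along the belt line, so the path never returns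
  -- to a seed.
  have hanti : StrictAnti fun m => (u m).x := by
    refine strictAnti_int_of_succ_lt fun m => ?_
    rw [hstep]
    exact mutIn_x_lt _ hK
  have hinj : Function.Injective u := fun m m' h => hanti.injective (congrArg State.x h)
  have hback (m : ℤ) : u (m - 1) = (u m).mutate K 2 := by
    have := hstep (m - 1)
    rw [sub_add_cancel] at this
    rw [this]
    exact (mutOut_mutIn _ (hacute _)).symm
  -- An acyclic neighbour of a belt seed arises from the source or the sink, as the third mutation
  -- gives a cyclic seed. This yields both fullness and maximality.
  have hnbr (m : ℤ) (t : State n) (ht : ¬ t.a + t.c ≤ n) (k : Fin 3) (h : t = (u m).mutate K k) :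
      t = u (m + 1) ∨ t = u (m - 1) := by
    rw [hstep, hback]
    fin_cases k
    · exact .inl h
    · exact absurd (h ▸ (u m).mutMid_le) ht
    · exact .inr h
  let g (m : ℤ) : mutationClass n Δ :=
    ⟨⟦(u m).seed F K⟧, (mem_mutationClass_iff hK hinit hpos _).2 ⟨_, hu m, rfl⟩⟩
  have ginj : Function.Injective g := fun m m' h =>
    hinj (seed_injective (congrArg Subtype.val h))
  have gadj (m m' : ℤ) : (exchangeGraph n Δ).Adj (g m) (g m') ↔
      (SimpleGraph.hasse ℤ).Adj m m' := by
    rw [exchangeGraph_adj_iff hK hpos (p := g m) (q := g m') rfl rfl, SimpleGraph.hasse_adj,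
      Order.covBy_iff_add_one_eq, Order.covBy_iff_add_one_eq, hinj.ne_iff]
    constructor
    · rintro ⟨-, k, hk⟩
      rcases hnbr m (u m') (hacute m') k hk with h | h
      · exact .inl (hinj h).symm
      · right; rw [hinj h]; ring
    · rintro (rfl | rfl)
      · exact ⟨by simp, 0, hstep m⟩
      · refine ⟨by simp, 2, ?_⟩
        rw [← hback, add_sub_cancel_right]
  let f : SimpleGraph.hasse ℤ ↪g exchangeGraph n Δ := ⟨⟨g, ginj⟩, fun {m m'} => gadj m m'⟩
  refine ⟨f, fun m => rfl, ⟨?_, ?_⟩, ?_⟩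
  · rintro _ ⟨m, rfl⟩
    exact (isAcyclic_seed_iff (u m)).2 (hacute m)
  · let F' : SimpleGraph.hasse ℤ →g (exchangeGraph n Δ).induce (Set.range f) :=
      ⟨fun m => ⟨f m, m, rfl⟩, fun {m m'} h => (gadj m m').2 h⟩
    refine SimpleGraph.Connected.map F' ?_ ⟨SimpleGraph.hasse_preconnected_of_succ ℤ⟩
    rintro ⟨_, m, rfl⟩
    exact ⟨m, rfl⟩
  · rintro J ⟨hJ, hconn⟩ hfJ q hq
    have h0 : f 0 ∈ J := hfJ ⟨0, rfl⟩
    have hr := hconn.preconnected ⟨f 0, h0⟩ ⟨q, hq⟩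
    rw [SimpleGraph.reachable_iff_reflTransGen] at hr
    have key : ∀ z : J, Relation.ReflTransGen ((exchangeGraph n Δ).induce J).Adj ⟨f 0, h0⟩ z →
        (z : mutationClass n Δ) ∈ Set.range f := by
      intro z hz
      induction hz with
      | refl => exact ⟨0, rfl⟩
      | @tail y z _ hyz ih =>
        obtain ⟨m, hm⟩ := ih
        have hadj : (exchangeGraph n Δ).Adj (y : mutationClass n Δ) z := hyz
        rw [← hm] at hadj
        obtain ⟨t, ht, e⟩ := (mem_mutationClass_iff hK hinit hpos _).1 (z : mutationClass n Δ).2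
        have hac := hJ z z.2
        rw [e, isAcyclic_seed_iff] at hac
        obtain ⟨-, k, hk⟩ := (exchangeGraph_adj_iff hK hpos (p := f m) rfl e).1 hadj
        rcases hnbr m t hac k hk with h | h
        · exact ⟨m + 1, Subtype.ext (by rw [e, h]; rfl)⟩
        · exact ⟨m - 1, Subtype.ext (by rw [e, h]; rfl)⟩
    exact key ⟨q, hq⟩ hr

/-- Acyclic parameters stay acyclic under source and sink mutations, which are inverse to each
other; iterating them gives the two halves of the belt. -/
theorem exists_initialBelt (hK : 0 < K)
    (hinit : initialLabelledSeed n Δ = (initialState n hn).seed F K) (hpos : positive Δ = F.pos) :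
    ∃ I, IsInitialBelt n Δ I := by
  let S := {t : State n // Orb K (initialState n hn) t ∧ ¬ t.a + t.c ≤ n}
  let next (t : S) : S := ⟨t.1.mutate K 0, t.2.1.tail ⟨0, rfl⟩, by
    have h1 := t.1.a_le
    have h2 := t.1.c_le
    have h3 := t.2.2
    have ea : (t.1.mutate K 0).a = _ := mutIn_a (K := K) t.1 h3
    have ec : (t.1.mutate K 0).c = _ := mutIn_c (K := K) t.1 h3
    rw [ea, ec]; omega⟩
  let prev (t : S) : S := ⟨t.1.mutate K 2, t.2.1.tail ⟨2, rfl⟩, by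
    have h1 := t.1.a_le
    have h2 := t.1.c_le
    have h3 := t.2.2
    change ¬ (t.1.mutOut K).a + (t.1.mutOut K).c ≤ n
    simp only [mutOut, h3, dif_neg, not_false_eq_true]
    omega⟩
  have hnp (t : S) : next (prev t) = t := Subtype.ext (mutIn_mutOut t.1 t.2.2)
  let o : S := ⟨initialState n hn, .refl, by simp [initialState]⟩
  -- `Int.negSucc k` stands for -(k + 1), hence the extra iteration of `prev`.
  let u : ℤ → S := fun m => match m with
    | Int.ofNat k => next^[k] o
    | Int.negSucc k => prev^[k + 1] o
  have hu (m : ℤ) : u (m + 1) = next (u m) := by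
    match m with
    | Int.ofNat k => exact Function.iterate_succ_apply' next k o
    | Int.negSucc 0 => exact (hnp o).symm
    | Int.negSucc (k + 1) =>
      change prev^[k + 1] o = next (prev^[k + 1 + 1] o)
      rw [Function.iterate_succ_apply' prev (k + 1), hnp]
  refine ⟨fun m => ⟨⟦(u m).1.seed F K⟧,
    (mem_mutationClass_iff hK hinit hpos _).2 ⟨_, (u m).2.1, rfl⟩⟩, ?_, fun m => ?_⟩
  · change (⟦(initialState n hn).seed F K⟧ : Seed) = ⟦initialLabelledSeed n Δ⟧
    rw [hinit]
  · rw [hpos, source_step_iff _ hK]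
    refine ⟨(u m).2.2, ?_⟩
    change (⟦(u (m + 1)).1.seed F K⟧ : Seed) = ⟦(next (u m)).1.seed F K⟧
    rw [hu]

/-- Two seeds of a mutation class with the same angles differ by a translation or by a glide
reflection. -/
theorem glide_of_same_angles {hK : 0 < K} {o s t : State n} {y : ℝ}
    (hy : Orb K o (o.glide (-1) y (by norm_num))) (hs : Orb K o s) (ht : Orb K o t)
    (ha : t.a = s.a) (hc : t.c = s.c) :
    (∃ r ∈ period F hK o, t = s.glide 1 r (one_pow 2)) ∨
      ∃ r ∈ period F hK o, t = (s.glide (-1) 0 (by norm_num)).glide 1 (y + r) (one_pow 2) := by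
  have hε : t.ε = s.ε ∨ t.ε = -s.ε := by
    rw [← sq_eq_sq_iff_eq_or_eq_neg, t.ε_sq, s.ε_sq]
  rcases hε with hε | hε
  · left
    have e : t = s.glide 1 (t.x - s.x) (one_pow 2) := by ext <;> simp [glide, ha, hc, hε]
    exact ⟨_, (mem_period F hs).2 (e ▸ ht), e⟩
  · right
    have hm : (-1 : ℝ) ^ 2 = 1 := by norm_num
    have e : t = s.glide (-1) (t.x - s.x) hm := by ext <;> simp [glide, ha, hc, hε]
    have h1 : Orb K o (o.glide (-1) (t.x - s.x) hm) :=
      Orb.glide_mem F hK hs (e ▸ ht) .refl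
    -- Any two glide reflections compatible with the class differ by a translation, which is then a
    -- period.
    have h2 : (o.glide (-1) y hm).glide 1 (t.x - s.x - y) (one_pow 2) =
        o.glide (-1) (t.x - s.x) hm := glide_glide o hm (by ring) (by ring)
    refine ⟨t.x - s.x - y, (mem_period F hy).2 (h2 ▸ h1), ?_⟩
    rw [glide_glide s hm (by ring) (by ring : 0 + (y + (t.x - s.x - y)) = t.x - s.x)]
    exact e

/-- Two zero angles are impossible: the gcd would be 2n + 1 > 1. Since at most one angle exceeds
`n`, two of the others can serve as `a` ≥ 1 and `c`. Nothing is claimed here about occurrence in the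
class. -/
theorem exists_state_ang {m : Fin 3 → ℕ} (hn : 1 ≤ n) (hm : m 0 + m 1 + m 2 = 2 * n + 1)
    (hg : Nat.gcd (m 0) (Nat.gcd (m 1) (m 2)) = 1) :
    ∃ (s : State n) (σ : Equiv.Perm (Fin 3)), ∀ i, s.ang (σ i) = m i := by
  have h01 : ¬ (m 0 = 0 ∧ m 1 = 0) := by
    rintro ⟨h, h'⟩; simp only [h, h', Nat.gcd_zero_left] at hg; omega
  have h02 : ¬ (m 0 = 0 ∧ m 2 = 0) := by
    rintro ⟨h, h'⟩; simp only [h, h', Nat.gcd_zero_left, Nat.gcd_zero_right] at hg; omega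
  have h12 : ¬ (m 1 = 0 ∧ m 2 = 0) := by
    rintro ⟨h, h'⟩; simp only [h, h', Nat.gcd_zero_right] at hg; omega
  have main (ρ : Equiv.Perm (Fin 3)) (h0 : 1 ≤ m (ρ 0)) (h0' : m (ρ 0) ≤ n) (h2 : m (ρ 2) ≤ n) :
      ∃ (s : State n) (σ : Equiv.Perm (Fin 3)), ∀ i, s.ang (σ i) = m i := by
    refine ⟨⟨m (ρ 0), m (ρ 2), 1, 0, h0, h0', h2, one_pow 2⟩, ρ.symm, fun i => ?_⟩
    have hs : m (ρ 0) + m (ρ 1) + m (ρ 2) = 2 * n + 1 := by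
      rw [← hm, ← Fin.sum_univ_three fun i => m (ρ i), ← Fin.sum_univ_three m]
      exact Equiv.sum_comp ρ m
    obtain ⟨i, rfl⟩ := ρ.surjective i
    rw [Equiv.symm_apply_apply]
    fin_cases i
    · rfl
    · change 2 * n + 1 - (m (ρ 0) + m (ρ 2)) = m (ρ 1)
      omega
    · rfl
  have cases : (1 ≤ m 0 ∧ m 0 ≤ n ∧ m 2 ≤ n) ∨ (1 ≤ m 0 ∧ m 0 ≤ n ∧ m 1 ≤ n) ∨
      (1 ≤ m 1 ∧ m 1 ≤ n ∧ m 0 ≤ n) ∨ (1 ≤ m 1 ∧ m 1 ≤ n ∧ m 2 ≤ n) ∨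
      (1 ≤ m 2 ∧ m 2 ≤ n ∧ m 0 ≤ n) ∨ (1 ≤ m 2 ∧ m 2 ≤ n ∧ m 1 ≤ n) := by omega
  rcases cases with ⟨h, h', h''⟩ | ⟨h, h', h''⟩ | ⟨h, h', h''⟩ | ⟨h, h', h''⟩ | ⟨h, h', h''⟩ |
    ⟨h, h', h''⟩
  · exact main 1 h h' h''
  · exact main (Equiv.swap 1 2) h h' h''
  · exact main (finRotate 3) h h' h''
  · exact main (Equiv.swap 0 1) h h' h''
  · exact main (Equiv.swap 0 2) h h' h''
  · exact main rot h h' h''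

end Class

end AffineSeed
end

/-! ### The theorem -/

open AffineSeed in
theorem theorem5p3 (n : ℕ) (hn : 1 ≤ n) (Δ₀ : Affine.Triangle ℝ Plane)
    (hΔ₀ : IsInitialTriangle n Δ₀) :
    ((∃ I, IsInitialBelt n Δ₀ I) ∧
      ∀ I, IsInitialBelt n Δ₀ I → ∀ w ∈ translationLattice n Δ₀,
        ∃ f : SimpleGraph.hasse ℤ ↪g exchangeGraph n Δ₀,
          (∀ m, (f m : Seed) = (I m : Seed).translate w) ∧
          IsAcyclicBelt n Δ₀ (Set.range f)) ∧
    (∃ h : Plane, (2 : ℝ) • h ∈ translationLattice n Δ₀ ∧ ∀ m : Fin 3 → ℕ, m 0 + m 1 + m 2 = 2 * n + 1 →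
      Nat.gcd (m 0) (Nat.gcd (m 1) (m 2)) = 1 →
      ∃ D : Fin 3 → AffFun,
        (∀ i, (D i).form (D i) = 2) ∧
        HasAngles D (fun i => m i * fundAngle n) ∧
        (∀ x : LabelledSeed, (⟦x⟧ : Seed) ∈ mutationClass n Δ₀ →
          HasAngles x.v (fun i => m i * fundAngle n) → AreCongruent x.v D) ∧
        ∀ Q, IsQuiverOf (fun i => m i * fundAngle n) Q →
          (∃ s ∈ seedsOfShape n Δ₀ D Q, ∃ t ∈ seedsOfShape n Δ₀ D Q,
            (¬ ∃ w ∈ translationLattice n Δ₀, (t : Seed) = (s : Seed).translate w) ∧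
            ∀ r ∈ seedsOfShape n Δ₀ D Q,
              (∃ w ∈ translationLattice n Δ₀, (r : Seed) = (s : Seed).translate w) ∨
              ∃ w ∈ translationLattice n Δ₀, (r : Seed) = (t : Seed).translate w) ∧
          ∀ s ∈ seedsOfShape n Δ₀ D Q, ∀ t ∈ seedsOfShape n Δ₀ D Q,
            (∃ w ∈ translationLattice n Δ₀, (t : Seed) = (s : Seed).translate w) ∨
            ∃ w ∈ translationLattice n Δ₀,
              (t : Seed) = ((s : Seed).move (beltReflection Δ₀)).translate (h + w)) := by
  obtain ⟨F, K, hK, hinit, hpos, haxis, hunit⟩ := exists_frame hn hΔ₀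
  have hlat := mem_translationLattice_iff hK hinit hpos hunit
  have hcls := mem_mutationClass_iff hK hinit hpos
  set o := initialState n hn with ho
  refine ⟨⟨exists_initialBelt hK hinit hpos, ?_⟩, ?_⟩
  · rintro I ⟨-, hI⟩ w hw
    obtain ⟨r, hr, rfl⟩ := (hlat w).1 hw
    choose t ht he using fun m => (hcls (I m)).1 (I m).2
    have hsrc (m : ℤ) : ¬ (t m).a + (t m).c ≤ n ∧ t (m + 1) = (t m).mutate K 0 := by
      have := hI m
      rw [hpos, he m, State.source_step_iff _ hK, he (m + 1)] at this
      exact ⟨this.1, State.seed_injective this.2⟩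
    obtain ⟨f, hf, hbelt⟩ := exists_belt hK hinit hpos
      (u := fun m => (t m).glide 1 r (one_pow 2)) (fun m => (State.mem_period F (ht m)).1 hr)
      (fun m => (hsrc m).1) (fun m => by rw [State.mutate_glide, (hsrc m).2])
    refine ⟨f, fun m => ?_, hbelt⟩
    rw [hf, he, State.seed_glide_one]
  · obtain ⟨y, hy⟩ := State.exists_glide (K := K) o hn rfl rfl
    -- The vector h is the displacement of the glide reflection found above; performing the glide
    -- twice is a translation by 2h, which is a period.
    refine ⟨y • F.b 0, (hlat _).2 ⟨y + y, ?_, by module⟩, fun m hm hg => ?_⟩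
    · have h := State.Orb.glide_mem F hK .refl hy hy
      rw [State.glide_glide o (one_pow 2) (by norm_num) rfl] at h
      exact h
    obtain ⟨d, ρ, hd⟩ := exists_state_ang hn hm hg
    have hcong (t : State n) (τ : Equiv.Perm (Fin 3)) (h : ∀ i, t.ang (τ i) = m i) :
        AreCongruent ((t.seed F K).perm τ).v ((d.seed F K).perm ρ).v :=
      State.areCongruent_perm h hd
    refine ⟨((d.seed F K).perm ρ).v, fun i => d.seed_form_self _, d.hasAngles_perm hK hd, ?_, ?_⟩
    · intro x hx hang
      obtain ⟨t, -, e⟩ := (hcls _).1 hx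
      obtain ⟨τ, rfl⟩ := (LabelledSeed.mk_eq_iff _ _).1 e.symm
      exact hcong t τ (t.ang_eq_of_hasAngles hang)
    intro Q hQ
    obtain ⟨σ, a, c, ha, han, hcn, hgcd, hac⟩ := hQ.exists_perm hm hg
    have hmem (q : mutationClass n Δ₀) (t : State n) (hq : (q : Seed) = ⟦t.seed F K⟧)
        (ht : t.a = a) (ht' : t.c = c) :
        q ∈ seedsOfShape n Δ₀ ((d.seed F K).perm ρ).v Q := by
      obtain ⟨h1, h2⟩ := hac F K t ht ht'
      exact ⟨(t.seed F K).perm σ, by rw [LabelledSeed.mk_perm, hq], hcong t σ h1, h2⟩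
    obtain ⟨t₁, ht₁, ha₁, hc₁⟩ := State.occurs_of_gcd_eq_one (K := K) o rfl ha han hcn hgcd
    -- A seed of this shape has the scalar products and the quiver of the seed of `t₁` up to
    -- labelling, so rigidity gives it the same pair (a, c).
    have hshape : ∀ q ∈ seedsOfShape n Δ₀ ((d.seed F K).perm ρ).v Q,
        ∃ t, State.Orb K o t ∧ (q : Seed) = ⟦t.seed F K⟧ ∧ t.a = a ∧ t.c = c := by
      rintro q ⟨x, hx, hxc, hxB⟩
      obtain ⟨t, ht, e⟩ := (hcls q).1 q.2
      rw [← hx] at e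
      obtain ⟨τ, rfl⟩ := (LabelledSeed.mk_eq_iff _ _).1 e.symm
      obtain ⟨h1, h2⟩ := hac F K t₁ ha₁ hc₁
      have hf (i j : Fin 3) := (hxc.form_eq i j).trans ((hcong t₁ σ h1).form_eq i j).symm
      obtain ⟨-, h3, h4⟩ := State.perm_eq_one (F := F) (K := K) (s := t₁) (t := t)
        (σ := τ.symm.trans σ) (fun i j => by
          have := hf (τ.symm i) (τ.symm j)
          simpa [LabelledSeed.perm] using this) (by
          have h5 : (t.seed F K).B.submatrix τ τ = (t₁.seed F K).B.submatrix σ σ :=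
            hxB.trans h2.symm
          ext i j
          simpa using congrFun (congrFun h5 (τ.symm i)) (τ.symm j))
      exact ⟨t, ht, by rw [← hx, e], h3.trans ha₁, h4.trans hc₁⟩
    have hm1 : (-1 : ℝ) ^ 2 = 1 := by norm_num
    have ht₂ : State.Orb K o (t₁.glide (-1) y hm1) := State.Orb.glide_mem F hK .refl hy ht₁
    constructor
    · refine ⟨⟨⟦t₁.seed F K⟧, (hcls _).2 ⟨_, ht₁, rfl⟩⟩, hmem _ t₁ rfl ha₁ hc₁,
        ⟨⟦(t₁.glide (-1) y hm1).seed F K⟧, (hcls _).2 ⟨_, ht₂, rfl⟩⟩,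
        hmem _ (t₁.glide (-1) y hm1) rfl ha₁ hc₁, ?_, ?_⟩
      -- A translation preserves the orientation `ε`, while the two chosen seeds have opposite ones.
      · rintro ⟨w, -, h⟩
        obtain ⟨r, -, e⟩ := State.seed_translate_eq h
        have h1 : -1 * t₁.ε = 1 * t₁.ε := congrArg State.ε e
        have h2 : t₁.ε = 0 := by linarith
        have h3 := t₁.ε_sq
        rw [h2] at h3
        norm_num at h3
      · intro q hq
        obtain ⟨t, ht, e, hta, htc⟩ := hshape q hq
        rcases glide_of_same_angles (F := F) (hK := hK) hy ht₁ ht (hta.trans ha₁.symm)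
          (htc.trans hc₁.symm) with ⟨r, hr, rfl⟩ | ⟨r, hr, rfl⟩
        · exact .inl ⟨r • F.b 0, (hlat _).2 ⟨r, hr, rfl⟩, by rw [e, State.seed_glide_one]⟩
        · refine .inr ⟨r • F.b 0, (hlat _).2 ⟨r, hr, rfl⟩, ?_⟩
          rw [e, ← State.seed_glide_one, State.glide_glide t₁ hm1 (by ring) rfl,
            State.glide_glide t₁ hm1 (by ring) (zero_add _).symm]
    · intro p hp q hq
      obtain ⟨s, hs, e, hsa, hsc⟩ := hshape p hp
      obtain ⟨t, ht, e', hta, htc⟩ := hshape q hq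
      rcases glide_of_same_angles (F := F) (hK := hK) hy hs ht (hta.trans hsa.symm)
        (htc.trans hsc.symm) with ⟨r, hr, rfl⟩ | ⟨r, hr, rfl⟩
      · exact .inl ⟨r • F.b 0, (hlat _).2 ⟨r, hr, rfl⟩, by rw [e, e', State.seed_glide_one]⟩
      · refine .inr ⟨r • F.b 0, (hlat _).2 ⟨r, hr, rfl⟩, ?_⟩
        rw [e, e', State.seed_glide_one, State.seed_glide_neg_one s (beltLine Δ₀) haxis, add_smul]
        rfl
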